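/- Let $\mathrm{SU}(2)$ be the group of unit quaternions and let $\mathrm{SU}(2)^3$ act on $M=\mathrm{S}^3\times \mathrm{S}^3=\mathrm{SU}(2)\times\mathrm{SU}(2)$ by $(a,b,c)\cdot(x,y)=(axc^{-1},byc^{-1})$. This action is transitive and the isotropy group of $(1,1)$ is the diagonal $\Delta\mathrm{SU}(2)$, so $M=\mathrm{SU}(2)^3/\Delta \mathrm{SU}(2)$. Let $B$ be the Killing form of the Lie algebra $\mathfrak g=\mathfrak{su}(2)^3$, let $\mathfrak h\subset\mathfrak g$ be the diagonal (the isotropy subalgebra of $(1,1)$), and let $\mathfrak p$ be the $B$-orthogonal complement of $\mathfrak h$, identified with $T_{(1,1)}M$ by the differential of the orbit map $k\mapsto k\cdot(1,1)$. There is a unique $\mathrm{SU}(2)^3$-invariant smooth Riemannian metric $g$ on $M$ whose value on $T_{(1,1)}M\cong\mathfrak p$ is $-B|_{\mathfrak p\times\mathfrak p}$. Let $\nabla$ be its Levi-Civita connection, $R(X,Y)Z=\nabla_X\nabla_YZ-\nabla_Y\nabla_XZ-\nabla_{[X,Y]}Z$ and $R(X,Y,Z,W)=g(R(X,Y)W,Z)$,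 so that $\sec(X,Y)=R(X,Y,X,Y)$ for orthonormal $X,Y$. Equip $\bigwedge^2TM$ with the inner product $\langle X\wedge Y,Z\wedge W\rangle=2\,(g(X,Z)g(Y,W)-g(X,W)g(Y,Z))$, and let $\mathfrak R$ be the curvature operator, i.e. the endomorphism of $\bigwedge^2TM$ with $\langle \mathfrak R(X\wedge Y),Z\wedge W\rangle=2R(X,Y,Z,W)$. Then: 1. $(M,g)$ is (strictly) nearly Kähler: there is a smooth $g$-orthogonal almost complex structure $J$ with $(\nabla_XJ)X=0$ for all $X$, and $\nabla J\neq0$. 2. $g$ is Einstein with Einstein constant $\frac5{12}$: $\mathrm{Ric}=\frac5{12}g$. 3. $(M,g)$ is not a Riemannian symmetric space, i.e. it is not the case that for every point $x$ there is an isometry of $(M,g)$ fixing $x$ with differential $-\mathrm{id}$ at $x$. 4. At every point, the eigenvalues of $\mathfrak R$ are exactly $\frac7{24}$, with multiplicity $3$, $\frac1{12}$, with multiplicity $7$, and $-\frac1{24}$, with multiplicity $5$. In particular the largest eigenvalue of $\mathfrak R$ is strictly less than the Einstein constant $\frac5{12}$. -/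

import Mathlib

noncomputable section

open scoped Manifold ContDiff Quaternion
open VectorField

namespace NearlyKahlerS3S3

/-! ### Riemannian geometry: Levi-Civita connection, curvature, curvature operator -/

section Riemannian

variable {E : Type*} [NormedAddCommGroup E] [NormedSpace ℝ E]
  {H : Type*} [TopologicalSpace H] (I : ModelWithCorners ℝ E H)
  (M : Type*) [TopologicalSpace M] [ChartedSpace H M] [IsManifold I ∞ M]

/-- Smooth Riemannian metrics on the manifold `M`. -/
abbrev SmoothMetric : Type _ :=
  Bundle.ContMDiffRiemannianMetric I ∞ E (fun x : M ↦ TangentSpace I x)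

/-- Affine connections on `M`. The vector `∇_{X x} Y` at `x` is written `cov Y x (X x)`. -/
abbrev Connection : Type _ :=
  CovariantDerivative I E (fun x : M ↦ TangentSpace I x)

variable {I M}

/-- Smooth vector fields. -/
def IsSmoothField (X : Π x : M, TangentSpace I x) : Prop :=
  ContMDiff I I.tangent ∞ (fun x ↦ (⟨x, X x⟩ : TangentBundle I M))

/-- The vector field `∇_X Y`. -/
def nabla (cov : Connection I M) (X Y : Π x : M, TangentSpace I x) :
    Π x : M, TangentSpace I x :=
  fun x ↦ cov Y x (X x)

/-- `cov` is the Levi-Civita connection of `g`: it is torsion-free and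
`X (g(Y,Z)) = g(∇_X Y, Z) + g(Y, ∇_X Z)`. -/
def IsLeviCivita [FiniteDimensional ℝ E] (g : SmoothMetric I M)
    (cov : Connection I M) : Prop :=
  cov.torsion = 0 ∧
  ∀ X Y Z : Π x : M, TangentSpace I x, IsSmoothField X → IsSmoothField Y → IsSmoothField Z →
    ∀ x : M, mvfderiv I (fun y ↦ g.inner y (Y y) (Z y)) x (X x)
      = g.inner x (nabla cov X Y x) (Z x) + g.inner x (Y x) (nabla cov X Z x)

/-- The vector field `R(X,Y)Z = ∇_X ∇_Y Z - ∇_Y ∇_X Z - ∇_{[X,Y]} Z`. -/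
def curvatureField (cov : Connection I M) (X Y Z : Π x : M, TangentSpace I x) :
    Π x : M, TangentSpace I x :=
  nabla cov X (nabla cov Y Z) - nabla cov Y (nabla cov X Z) - nabla cov (mlieBracket I X Y) Z

/-- Trilinear maps `(u, v, w) ↦ R(u,v)w` on all tangent spaces. -/
abbrev CurvatureTensor (I : ModelWithCorners ℝ E H) (M : Type*) [TopologicalSpace M]
    [ChartedSpace H M] : Type _ :=
  Π x : M, TangentSpace I x →ₗ[ℝ] TangentSpace I x →ₗ[ℝ] TangentSpace I x →ₗ[ℝ] TangentSpace I x

/-- `R` is the curvature tensor of `cov`. -/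
def IsCurvatureTensor (cov : Connection I M) (R : CurvatureTensor I M) : Prop :=
  ∀ X Y Z : Π x : M, TangentSpace I x, IsSmoothField X → IsSmoothField Y → IsSmoothField Z →
    ∀ x : M, R x (X x) (Y x) (Z x) = curvatureField cov X Y Z x

/-- The `(0,4)` curvature tensor, normalized so that `R(X,Y,X,Y)` is the sectional curvature of
an orthonormal pair. -/
def curvature4 (g : SmoothMetric I M) (R : CurvatureTensor I M) (x : M)
    (X Y Z W : TangentSpace I x) : ℝ :=
  g.inner x (R x X Y W) Z

/-- Ricci curvature `Ric(v,w) = tr (u ↦ R(u,v)w)`. -/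
def ricci (R : CurvatureTensor I M) (x : M) (v w : TangentSpace I x) : ℝ :=
  LinearMap.trace ℝ (TangentSpace I x) (((R x).flip v).flip w)

/-- `g` is Einstein with Einstein constant `ρ`: `Ric = ρ g`. -/
def IsEinstein (g : SmoothMetric I M) (R : CurvatureTensor I M) (ρ : ℝ) : Prop :=
  ∀ (x : M) (v w : TangentSpace I x), ricci R x v w = ρ * g.inner x v w

/-- The second exterior power of the tangent space. -/
abbrev Bivector (I : ModelWithCorners ℝ E H) {M : Type*} [TopologicalSpace M]
    [ChartedSpace H M] (x : M) : Type _ :=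
  ⋀[ℝ]^2 (TangentSpace I x)

/-- The bivector `X ∧ Y`. -/
def wedge {x : M} (X Y : TangentSpace I x) : Bivector I x :=
  exteriorPower.ιMulti ℝ 2 ![X, Y]

/-- The linear map `v ↦ g(v, ·)` from the tangent space to its dual. -/
def flat (g : SmoothMetric I M) (x : M) : TangentSpace I x →ₗ[ℝ] Module.Dual ℝ (TangentSpace I x) where
  toFun v := (g.inner x v).toLinearMap
  map_add' v w := by ext; simp
  map_smul' c v := by ext; simp

/-- The tensor metric on bivectors,
`⟨X ∧ Y, Z ∧ W⟩ = 2 (g(X,Z) g(Y,W) - g(X,W) g(Y,Z))`, so `|X ∧ Y|² = 2` for orthonormal `X, Y`. -/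
def bivectorInner (g : SmoothMetric I M) (x : M) :
    Bivector I x →ₗ[ℝ] Module.Dual ℝ (Bivector I x) :=
  (2 : ℝ) • (exteriorPower.pairingDual ℝ (TangentSpace I x) 2).comp
    (exteriorPower.map 2 (flat g x))

theorem bivectorInner_wedge (g : SmoothMetric I M) (x : M) (X Y Z W : TangentSpace I x) :
    bivectorInner g x (wedge X Y) (wedge Z W)
      = 2 * (g.inner x X Z * g.inner x Y W - g.inner x X W * g.inner x Y Z) := by
  simp [bivectorInner, wedge, flat, Matrix.det_fin_two]
  ring

/-- `𝓡` is the curvature operator at `x`: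
`⟨𝓡(X ∧ Y), Z ∧ W⟩ = 2 R(X,Y,Z,W)` for all tangent vectors at `x`. -/
def IsCurvatureOperatorAt (g : SmoothMetric I M) (R : CurvatureTensor I M) (x : M)
    (Rop : Module.End ℝ (Bivector I x)) : Prop :=
  ∀ X Y Z W : TangentSpace I x,
    bivectorInner g x (Rop (wedge X Y)) (wedge Z W) = 2 * curvature4 g R x X Y Z W

/-- `g`, with Levi-Civita connection `cov`, is nearly Kähler and not Kähler: there is a smooth
`g`-orthogonal almost complex structure `J` with `(∇_X J) X = 0` for all vector fields `X`,
and `∇ J ≠ 0`. -/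
def IsStrictNearlyKahler (g : SmoothMetric I M) (cov : Connection I M) : Prop :=
  ∃ J : Π x : M, TangentSpace I x →ₗ[ℝ] TangentSpace I x,
    (∀ X : Π x : M, TangentSpace I x, IsSmoothField X → IsSmoothField fun x ↦ J x (X x)) ∧
    (∀ (x : M) (v : TangentSpace I x), J x (J x v) = -v) ∧
    (∀ (x : M) (v w : TangentSpace I x), g.inner x (J x v) (J x w) = g.inner x v w) ∧
    (∀ X : Π x : M, TangentSpace I x, IsSmoothField X →
      ∀ x : M, nabla cov X (fun y ↦ J y (X y)) x - J x (nabla cov X X x) = 0) ∧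
    (∃ X Y : Π x : M, TangentSpace I x, IsSmoothField X ∧ IsSmoothField Y ∧
      ∃ x : M, nabla cov X (fun y ↦ J y (Y y)) x - J x (nabla cov X Y x) ≠ 0)

/-- `(M, g)` is a Riemannian symmetric space: for each point `x` there is an isometry which fixes
`x` and whose differential at `x` is `-id`. -/
def IsSymmetricSpace (g : SmoothMetric I M) : Prop :=
  ∀ x : M, ∃ s : M ≃ₘ⟮I, I⟯ M,
    (∀ (y : M) (u v : TangentSpace I y),
      g.inner (s y) (mfderiv I I s y u) (mfderiv I I s y v) = g.inner y u v) ∧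
    s x = x ∧ ∀ v : TangentSpace I x, (mfderiv I I s x v : E) = -(v : E)

end Riemannian

/-! ### The group `SU(2)³`, the space `S³ × S³ = SU(2)³ / Δ SU(2)` and its standard metric -/

/-- The unit quaternions. As a Lie group this is `SU(2)`, see `S3.equivSU2`. -/
abbrev S3 : Type := Metric.sphere (0 : ℍ[ℝ]) 1

instance : Fact (Module.finrank ℝ ℍ[ℝ] = 3 + 1) := ⟨Quaternion.finrank_eq_four⟩

instance : LieGroup (𝓡 3) ω S3 where
  contMDiff_mul := by
    apply ContMDiff.codRestrict_sphere
    let c : S3 → ℍ[ℝ] := (↑)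
    have h₂ : ContMDiff (𝓘(ℝ, ℍ[ℝ]).prod 𝓘(ℝ, ℍ[ℝ])) 𝓘(ℝ, ℍ[ℝ]) ω
        fun z : ℍ[ℝ] × ℍ[ℝ] => z.fst * z.snd := by
      rw [contMDiff_iff]
      exact ⟨continuous_mul, fun x y => contDiff_mul.contDiffOn⟩
    suffices h₁ : ContMDiff _ _ _ (Prod.map c c) from
      h₂.comp h₁
    apply ContMDiff.prodMap <;> exact contMDiff_coe_sphere
  contMDiff_inv := by
    apply ContMDiff.codRestrict_sphere
    have h (x : S3) : (x : ℍ[ℝ])⁻¹ = star (x : ℍ[ℝ]) := by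
      rw [Quaternion.inv_def, Quaternion.normSq_eq_norm_mul_self, norm_eq_of_mem_sphere x]
      simp
    let L : ℍ[ℝ] →ₗ[ℝ] ℍ[ℝ] :=
      { toFun := star, map_add' := star_add, map_smul' := fun c x ↦ by ext <;> simp }
    have h' : ContMDiff 𝓘(ℝ, ℍ[ℝ]) 𝓘(ℝ, ℍ[ℝ]) ω L :=
      (LinearMap.toContinuousLinearMap L).contDiff.contMDiff
    simp only [h]
    exact h'.comp contMDiff_coe_sphere

theorem S3.sq_sum (q : S3) :
    q.1.re ^ 2 + q.1.imI ^ 2 + q.1.imJ ^ 2 + q.1.imK ^ 2 = 1 := by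
  rw [← Quaternion.normSq_def', Quaternion.normSq_eq_norm_mul_self, norm_eq_of_mem_sphere q, one_mul]

theorem S3.mk_mem (q : ℍ[ℝ]) (h : q.re ^ 2 + q.imI ^ 2 + q.imJ ^ 2 + q.imK ^ 2 = 1) :
    q ∈ Metric.sphere (0 : ℍ[ℝ]) 1 := by
  refine mem_sphere_zero_iff_norm.2 ((sq_eq_sq₀ (norm_nonneg _) zero_le_one).1 ?_)
  rw [sq, ← Quaternion.normSq_eq_norm_mul_self, Quaternion.normSq_def', one_pow]
  exact h

/-- The isomorphism `q = a + b i + c j + d k ↦ [[a + b i, c + d i], [-c + d i, a - b i]]` of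
topological groups from the unit quaternions to `SU(2)`. -/
def S3.equivSU2 : S3 ≃ₜ* Matrix.specialUnitaryGroup (Fin 2) ℂ where
  toFun q := ⟨!![⟨q.1.re, q.1.imI⟩, ⟨q.1.imJ, q.1.imK⟩; ⟨-q.1.imJ, q.1.imK⟩, ⟨q.1.re, -q.1.imI⟩], by
    have h := q.sq_sum
    rw [Matrix.mem_specialUnitaryGroup_iff, Matrix.mem_unitaryGroup_iff]
    constructor
    · ext i j
      fin_cases i <;> fin_cases j <;>
        simp [Matrix.mul_apply, Matrix.star_apply, Complex.ext_iff] <;>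
        constructor <;> linarith
    · simp [Matrix.det_fin_two, Complex.ext_iff]
      constructor <;> linarith⟩
  invFun A := ⟨⟨(A.1 0 0).re, (A.1 0 0).im, (A.1 0 1).re, (A.1 0 1).im⟩, by
    have h := congrArg (fun B : Matrix (Fin 2) (Fin 2) ℂ ↦ (B 0 0).re)
      (Matrix.mem_unitaryGroup_iff.1 A.2.1)
    simp [Matrix.mul_apply, Matrix.star_apply] at h
    exact S3.mk_mem _ (by simp only; linarith)⟩
  left_inv q := by
    ext <;> simp
  right_inv A := by
    have h1 := Matrix.mem_unitaryGroup_iff.1 A.2.1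
    have h2 : A.1.det = 1 := (Matrix.mem_specialUnitaryGroup_iff.1 A.2).2
    have h3 : A.1.adjugate = star A.1 := by
      rw [← mul_one A.1.adjugate, ← h1, ← mul_assoc, Matrix.adjugate_mul, h2, one_smul, one_mul]
    have h4 := congrFun (congrFun h3 0) 0
    have h5 := congrFun (congrFun h3 1) 0
    simp [Matrix.adjugate_fin_two, Matrix.star_apply, Complex.ext_iff] at h4 h5
    ext i j
    fin_cases i <;> fin_cases j <;> simp [Complex.ext_iff] <;> constructor <;> linarith
  map_mul' p q := by
    ext i j
    fin_cases i <;> fin_cases j <;> simp [Complex.ext_iff] <;> constructor <;> ring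
  continuous_toFun := by
    have h {f g : S3 → ℝ} (hf : Continuous f) (hg : Continuous g) :
        Continuous fun q ↦ (⟨f q, g q⟩ : ℂ) :=
      Complex.equivRealProdCLM.symm.continuous.comp (hf.prodMk hg)
    have h0 : Continuous fun q : S3 ↦ q.1.re := Quaternion.continuous_re.comp continuous_subtype_val
    have h1 : Continuous fun q : S3 ↦ q.1.imI :=
      Quaternion.continuous_imI.comp continuous_subtype_val
    have h2 : Continuous fun q : S3 ↦ q.1.imJ :=
      Quaternion.continuous_imJ.comp continuous_subtype_val
    have h3 : Continuous fun q : S3 ↦ q.1.imK :=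
      Quaternion.continuous_imK.comp continuous_subtype_val
    refine Continuous.subtype_mk (continuous_matrix fun i j ↦ ?_) _
    fin_cases i <;> fin_cases j
    exacts [h h0 h1, h h2 h3, h h2.neg h3, h h0 h1.neg]
  continuous_invFun := by
    have h (i j : Fin 2) :
        Continuous fun A : Matrix.specialUnitaryGroup (Fin 2) ℂ ↦ A.1 i j :=
      continuous_subtype_val.matrix_elem i j
    have hr := fun i j ↦ Complex.continuous_re.comp (h i j)
    have hi := fun i j ↦ Complex.continuous_im.comp (h i j)
    refine Continuous.subtype_mk ?_ _
    have e : Continuous fun v : EuclideanSpace ℝ (Fin 4) ↦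
        Quaternion.linearIsometryEquivTuple.symm v :=
      Quaternion.linearIsometryEquivTuple.symm.continuous
    have k : Continuous fun A : Matrix.specialUnitaryGroup (Fin 2) ℂ ↦
        !₂[(A.1 0 0).re, (A.1 0 0).im, (A.1 0 1).re, (A.1 0 1).im] := by
      refine (PiLp.continuous_toLp 2 _).comp (continuous_pi fun i ↦ ?_)
      fin_cases i
      exacts [hr 0 0, hi 0 0, hr 0 1, hi 0 1]
    exact e.comp k

/-- The Lie group `SU(2)³`. -/
abbrev G : Type := S3 × S3 × S3

/-- The model with corners of `SU(2)³`. -/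
abbrev IG := (𝓡 3).prod ((𝓡 3).prod (𝓡 3))

/-- The manifold `S³ × S³`. -/
abbrev M : Type := S3 × S3

/-- The model with corners of `S³ × S³`. -/
abbrev IM := (𝓡 3).prod (𝓡 3)

/-- The action of `SU(2)³` on `S³ × S³`. -/
def act (k : G) (p : M) : M := (k.1 * p.1 * k.2.2⁻¹, k.2.1 * p.2 * k.2.2⁻¹)

/-- The diagonal subgroup `Δ SU(2)` of `SU(2)³`. -/
def diagonal : Subgroup G where
  carrier := {k | k.1 = k.2.2 ∧ k.2.1 = k.2.2}
  one_mem' := ⟨rfl, rfl⟩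
  mul_mem' := by rintro a b ⟨h1, h2⟩ ⟨h3, h4⟩; simp [h1, h2, h3, h4]
  inv_mem' := by rintro a ⟨h1, h2⟩; simp [h1, h2]

theorem act_one (p : M) : act 1 p = p := by simp [act]

theorem act_mul (k l : G) (p : M) : act (k * l) p = act k (act l p) := by
  simp [act, mul_assoc]

/-- The orbit map `SU(2)³ → S³ × S³` of the base point `(1, 1)`. -/
def proj (k : G) : M := act k 1

theorem proj_surjective : Function.Surjective proj := fun p ↦ ⟨(p.1, p.2, 1), by simp [proj, act]⟩

/-- The fibres of `proj` are the cosets of the diagonal: `S³ × S³ = SU(2)³ / Δ SU(2)`. -/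
theorem proj_eq_iff (k l : G) : proj k = proj l ↔ (k : G ⧸ diagonal) = l := by
  rw [QuotientGroup.eq]
  obtain ⟨a, b, c⟩ := k
  obtain ⟨a', b', c'⟩ := l
  have h (x x' : S3) : x * c⁻¹ = x' * c'⁻¹ ↔ x⁻¹ * x' = c⁻¹ * c' := by
    rw [inv_mul_eq_iff_eq_mul, ← mul_assoc, ← mul_inv_eq_iff_eq_mul, inv_inv, eq_comm]
  simpa [proj, act, diagonal] using and_congr (h a a') (h b b')

/-- The Lie algebra of `SU(2)³`. -/
abbrev 𝔤 : Type := GroupLieAlgebra IG G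

/-- The isotropy subalgebra (the diagonal `su(2)`): the kernel of the differential of the
orbit map at the identity. -/
def 𝔥 : Submodule ℝ 𝔤 := (mfderiv IG IM proj 1).ker

/-- The orthogonal complement of the isotropy subalgebra with respect to the Killing form. -/
def 𝔭 : Submodule ℝ 𝔤 := LinearMap.BilinForm.orthogonal (killingForm ℝ 𝔤) 𝔥

/-- `g` is the standard homogeneous metric: it is `SU(2)³`-invariant, and at the base point, where
the tangent space is identified with `𝔭` by the differential of the orbit map, it is minus the
Killing form of `SU(2)³`. -/
structure IsStandardMetric (g : SmoothMetric IM M) : Prop where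
  invariant : ∀ (k : G) (p : M) (u v : TangentSpace IM p),
    g.inner (act k p) (mfderiv IM IM (act k) p u) (mfderiv IM IM (act k) p v) = g.inner p u v
  base : ∀ X ∈ 𝔭, ∀ Y ∈ 𝔭,
    g.inner (proj 1) (mfderiv IG IM proj 1 X) (mfderiv IG IM proj 1 Y) = -killingForm ℝ 𝔤 X Y

end NearlyKahlerS3S3

end

/-! Everything is computed in a left-invariant frame. The Maurer-Cartan form of `S³ × S³ ⊂ ℍ × ℍ`,
with imaginary quaternions scaled by one half so that commutators become cross products, trivializes
the tangent bundle with fibre `V = ℝ³ × ℝ³`. A field is smooth exactly when its `V`-valued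
coefficient function is (`isSmoothField_iff`), and brackets obey the Maurer-Cartan equation
(`coframe_mlieBracket`). Each geometric object below is constant in this frame, so each claim
becomes an identity between cross and dot products.

In these coordinates the Killing form of `su(2)³` is `-2` times the sum of the three dot products,
`𝔥` is the diagonal, `𝔭` is `a + b + c = 0`, and the orbit map has differential `(a, b, c) ↦ (a - c,
b - c)`. Transporting `-B` gives the inner product `ip`. Left translations fix the coframe and the
right translation by `(c⁻¹, c⁻¹)` rotates both factors by the same rotation, so `ip` defines an
invariant metric; transitivity gives uniqueness (`IsStandardMetric.eq_metric`).

The Levi-Civita connection is `d + lc`, with `lc` the solution of the Koszul equations on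
left-invariant fields. The curvature is `curv a b = [lc a, lc b] - lc [a, b]`, and its trace yields
the Einstein constant. The almost complex structure is `J = (2σ + 1)/√3`, where `σ` is the
automorphism of order three permuting the factors of `SU(2)³` cyclically. An isometry preserves
`∇R`, which turns four vectors into one; a differential `-id` would therefore force `∇R = -∇R`, but
`dcurv` is not zero.

For the curvature operator, split `V` into the vectors `(u, u)` and `(u, -u)`, two copies of the
rotation representation `ℝ³`. Then `Λ²V` consists of three copies of `ℝ³`, one trivial line and one
space of traceless symmetric matrices, of dimension five. Explicit orthogonal bivectors adapted to
this splitting diagonalize the operator: one copy of `ℝ³` has eigenvalue `7/24`, the other two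
copies and the line have `1/12`, and the traceless symmetric part has `-1/24`. -/

noncomputable section

open scoped Manifold ContDiff Quaternion Matrix
open VectorField Bundle

namespace NearlyKahlerS3S3

/-! ### Vector-valued derivatives, smooth forms and brackets of vector fields -/

section General
variable {E : Type*} [NormedAddCommGroup E] [NormedSpace ℝ E]
  {H : Type*} [TopologicalSpace H] {I : ModelWithCorners ℝ E H}
  {M : Type*} [TopologicalSpace M] [ChartedSpace H M]
  {F : Type*} [NormedAddCommGroup F] [NormedSpace ℝ F]
  {V : Type*} [NormedAddCommGroup V] [NormedSpace ℝ V]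

theorem mvfderiv_clm_comp (L : F →L[ℝ] V) {f : M → F} {x : M}
    (hf : MDifferentiableAt I 𝓘(ℝ, F) f x) (v : TangentSpace I x) :
    mvfderiv I (fun y ↦ L (f y)) x v = L (mvfderiv I f x v) := by
  have h := mfderiv_comp x (g := L) (L.differentiableAt.mdifferentiableAt) hf
  have := congrArg (fun T ↦ T v) h
  simpa [mvfderiv, mfderiv_eq_fderiv, Function.comp_def] using! this

theorem mvfderiv_mul_algebra {A : Type*} [NormedRing A] [NormedAlgebra ℝ A] {f h : M → A} {x : M}
    (hf : MDifferentiableAt I 𝓘(ℝ, A) f x) (hh : MDifferentiableAt I 𝓘(ℝ, A) h x)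
    (v : TangentSpace I x) :
    mvfderiv I (fun y ↦ f y * h y) x v = f x * mvfderiv I h x v + mvfderiv I f x v * h x := by
  have := (hf.hasMFDerivAt.mul' hh.hasMFDerivAt).mfderiv
  have := congrArg (fun T ↦ T v) this
  simpa [mvfderiv] using! this

variable [IsManifold I ∞ M]

/-- Smooth one-forms with values in a normed space. -/
def IsSmoothForm (φ : ∀ x : M, TangentSpace I x →L[ℝ] V) : Prop :=
  ContMDiff I (I.prod 𝓘(ℝ, E →L[ℝ] V)) ∞ (fun x ↦ TotalSpace.mk' (E →L[ℝ] V)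
    (E := fun x : M ↦ TangentSpace I x →L[ℝ] Bundle.Trivial M V x) x (φ x))

theorem isSmoothForm_clm_comp_mvfderiv {f : M → F} {A : M → F →L[ℝ] V}
    (hf : ContMDiff I 𝓘(ℝ, F) ∞ f) (hA : ContMDiff I 𝓘(ℝ, F →L[ℝ] V) ∞ A) :
    IsSmoothForm fun x ↦ (A x).comp (mvfderiv I f x) := by
  intro x0
  rw [contMDiffAt_hom_bundle]
  refine ⟨contMDiffAt_id, ?_⟩
  have h := (hf x0).mfderiv_const (m := ∞) le_rfl
  have h2 := (hA x0).clm_comp h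
  refine h2.congr_of_eventuallyEq (Filter.Eventually.of_forall fun x ↦ ?_)
  ext v
  simp [inTangentCoordinates, ContinuousLinearMap.inCoordinates, mvfderiv]
  rfl

theorem IsSmoothField.apply_hom {φ : ∀ x : M, TangentSpace I x →L[ℝ] V}
    (hφ : IsSmoothForm φ)
    {X : ∀ x : M, TangentSpace I x} (hX : IsSmoothField X) :
    ContMDiff I 𝓘(ℝ, V) ∞ fun x ↦ φ x (X x) := by
  intro x
  have h := (hφ x).clm_bundle_apply (hX x)
  simp only [contMDiffAt_totalSpace] at h
  exact h.2

theorem MDifferentiableAt.apply_hom {φ : ∀ x : M, TangentSpace I x →L[ℝ] V}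
    (hφ : IsSmoothForm φ)
    {X : ∀ x : M, TangentSpace I x} {x : M}
    (hX : MDifferentiableAt I I.tangent (fun x ↦ (⟨x, X x⟩ : TangentBundle I M)) x) :
    MDifferentiableAt I 𝓘(ℝ, V) (fun x ↦ φ x (X x)) x := by
  have h := ((hφ x).mdifferentiableAt (by simp)).clm_bundle_apply hX
  simp only [mdifferentiableAt_totalSpace] at h
  exact h.2

theorem IsSmoothField.mvfderiv {f : M → F} (hf : ContMDiff I 𝓘(ℝ, F) ∞ f)
    {X : ∀ x : M, TangentSpace I x} (hX : IsSmoothField X) :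
    ContMDiff I 𝓘(ℝ, F) ∞ fun x ↦ mvfderiv I f x (X x) :=
  hX.apply_hom (isSmoothForm_clm_comp_mvfderiv hf
    (contMDiff_const (c := ContinuousLinearMap.id ℝ F)))

theorem IsSmoothField.mdifferentiableAt {X : ∀ x : M, TangentSpace I x} (hX : IsSmoothField X)
    (x : M) : MDifferentiableAt I I.tangent (fun x ↦ (⟨x, X x⟩ : TangentBundle I M)) x :=
  (hX x).mdifferentiableAt (by simp)

theorem two_le_infty : (2 : WithTop ℕ∞) ≤ ∞ :=
  ENat.LEInfty.out

theorem three_le_infty : (3 : WithTop ℕ∞) ≤ ∞ :=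
  ENat.LEInfty.out

theorem IsSmoothField.mlieBracket [CompleteSpace E] {X Y : ∀ x : M, TangentSpace I x}
    (hX : IsSmoothField X) (hY : IsSmoothField Y) : IsSmoothField (mlieBracket I X Y) := by
  have : IsManifold I (minSmoothness ℝ 2) M := IsManifold.of_le (n := ∞) (by simp [two_le_infty])
  have : IsManifold I (((⊤ : ℕ∞) : WithTop ℕ∞) + 1) M := ‹IsManifold I ∞ M›
  exact ContDiff.mlieBracket_vectorField (m := ⊤) (n := ⊤) hX hY (by simp)

/-- Brackets act on functions as commutators of derivations. This is extracted from the Jacobi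
identity for `X`, `Y`, `f Z`: expanding by the Leibniz rule and removing `f` times the Jacobi
identity for `X`, `Y`, `Z` leaves the desired scalar equation multiplied by `Z x`, whence the need
for a field with `Z x ≠ 0`. -/
theorem mvfderiv_mlieBracket_of_ne_zero [CompleteSpace E] {f : M → ℝ}
    (hf : ContMDiff I 𝓘(ℝ, ℝ) ∞ f)
    {X Y Z : ∀ x : M, TangentSpace I x} (hX : IsSmoothField X) (hY : IsSmoothField Y)
    (hZ : IsSmoothField Z) {x : M} (hZx : Z x ≠ 0) :
    mvfderiv I f x (mlieBracket I X Y x) =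
      mvfderiv I (fun y ↦ mvfderiv I f y (Y y)) x (X x) -
      mvfderiv I (fun y ↦ mvfderiv I f y (X y)) x (Y x) := by
  have : IsManifold I (minSmoothness ℝ 3) M := IsManifold.of_le (n := ∞) (by simp [three_le_infty])
  have hfd : ∀ y, MDifferentiableAt I 𝓘(ℝ, ℝ) f y := fun y ↦ (hf y).mdifferentiableAt (by simp)
  have hs {W : ∀ x : M, TangentSpace I x} (hW : IsSmoothField W) :
      ContMDiff I I.tangent (minSmoothness ℝ 2) (fun x ↦ (⟨x, W x⟩ : TangentBundle I M)) :=
    hW.of_le (by simp [two_le_infty])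
  have hbr {W : ∀ x : M, TangentSpace I x} :
      mlieBracket I W (f • Z) = (fun y ↦ mvfderiv I f y (W y)) • Z + f • mlieBracket I W Z := by
    funext y
    simpa using mlieBracket_smul_right (V := W) (hfd y) (hZ.mdifferentiableAt y)
  have hfZ : IsSmoothField (f • Z) := hf.smul_section hZ
  have key := leibniz_identity_mlieBracket_apply (x := x) (hs hX x) (hs hY x) (hs hfZ x)
  have hJ := leibniz_identity_mlieBracket_apply (x := x) (hs hX x) (hs hY x) (hs hZ x)
  have e1 {W W' : ∀ x : M, TangentSpace I x} (hW : IsSmoothField W) (hW' : IsSmoothField W') :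
      mlieBracket I W (mlieBracket I W' (f • Z)) x =
      mvfderiv I (fun y ↦ mvfderiv I f y (W' y)) x (W x) • Z x +
      mvfderiv I f x (W' x) • mlieBracket I W Z x + (mvfderiv I f x (W x) • mlieBracket I W' Z x
      + f x • mlieBracket I W (mlieBracket I W' Z) x) := by
    have h1 := hW'.mvfderiv hf
    have h2 : IsSmoothField (mlieBracket I W' Z) := hW'.mlieBracket hZ
    rw [hbr, mlieBracket_add_right ((IsSmoothField.mdifferentiableAt (h1.smul_section hZ)) x)
      ((IsSmoothField.mdifferentiableAt (hf.smul_section h2)) x),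
      mlieBracket_smul_right ((h1 x).mdifferentiableAt (by simp)) (hZ.mdifferentiableAt x),
      mlieBracket_smul_right (hfd x) (h2.mdifferentiableAt x)]
  rw [e1 hX hY, e1 hY hX, hbr, hJ] at key
  simp only [Pi.add_apply, Pi.smul_apply', smul_add] at key
  -- The mixed terms `(Wf) [W', Z]` occur on both sides and cancel; only the multiples of `Z x`
  -- survive.
  have aux {W : Type _} [AddCommGroup W] [Module ℝ W] {z u v w t : W} {a b c p q r : ℝ}
      (h : a • z + p • u + (q • v + (r • w + r • t)) =
        c • z + r • w + (b • z + q • v + (p • u + r • t))) : (c - (a - b)) • z = 0 := by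
    linear_combination (norm := module) (-1 : ℝ) • h
  have h3 : (mvfderiv I f x (mlieBracket I X Y x) -
      (mvfderiv I (fun y ↦ mvfderiv I f y (Y y)) x (X x) -
      mvfderiv I (fun y ↦ mvfderiv I f y (X y)) x (Y x))) • Z x = 0 := by
    exact aux key
  exact sub_eq_zero.1 ((smul_eq_zero.1 h3).resolve_right hZx)

theorem mvfderiv_mlieBracket [CompleteSpace E] {f : M → F} (hf : ContMDiff I 𝓘(ℝ, F) ∞ f)
    {X Y Z : ∀ x : M, TangentSpace I x} (hX : IsSmoothField X) (hY : IsSmoothField Y)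
    (hZ : IsSmoothField Z) {x : M} (hZx : Z x ≠ 0) :
    mvfderiv I f x (mlieBracket I X Y x) =
      mvfderiv I (fun y ↦ mvfderiv I f y (Y y)) x (X x) -
      mvfderiv I (fun y ↦ mvfderiv I f y (X y)) x (Y x) := by
  rw [← sub_eq_zero]
  refine SeparatingDual.eq_zero_of_forall_dual_eq_zero (R := ℝ) fun L ↦ ?_
  have h := mvfderiv_mlieBracket_of_ne_zero (f := fun y ↦ L (f y))
    (L.contDiff.contMDiff.comp hf ) hX hY hZ hZx
  have hd (y : M) := (hf y).mdifferentiableAt (by simp : (∞ : WithTop ℕ∞) ≠ 0)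
  have hdX := ((hX.mvfderiv hf) x).mdifferentiableAt (by simp : (∞ : WithTop ℕ∞) ≠ 0)
  have hdY := ((hY.mvfderiv hf) x).mdifferentiableAt (by simp : (∞ : WithTop ℕ∞) ≠ 0)
  simp only [mvfderiv_clm_comp L (hd _)] at h
  rw [mvfderiv_clm_comp L hdX, mvfderiv_clm_comp L hdY] at h
  rw [map_sub, map_sub, h, sub_self]

end General

/-! ### The Maurer-Cartan form of a smooth homomorphism into an algebra -/

section LieGroup
variable {E : Type*} [NormedAddCommGroup E] [NormedSpace ℝ E]
  {H : Type*} [TopologicalSpace H] {I : ModelWithCorners ℝ E H}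
  {K : Type*} [TopologicalSpace K] [ChartedSpace H K] [Group K]
  {A : Type*} [NormedRing A] [NormedAlgebra ℝ A]

/-- The pullback of the Maurer-Cartan form. -/
def maurerCartan (I : ModelWithCorners ℝ E H) (F : K →* A) (g : K) : TangentSpace I g →L[ℝ] A :=
  (ContinuousLinearMap.mul ℝ A (F g⁻¹)).comp (mvfderiv I F g)

theorem mvfderiv_eq_mul_maurerCartan (F : K →* A) (g : K) (v : TangentSpace I g) :
    mvfderiv I F g v = F g * maurerCartan I F g v := by
  simp [maurerCartan, ← mul_assoc, ← map_mul]

variable [LieGroup I ∞ K]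

/-- The value at `g` is the differential of multiplication applied to `(0_g, v)`, so the field is a
composite of smooth maps of tangent bundles. -/
theorem isSmoothField_mulInvariantVectorField (v : GroupLieAlgebra I K) :
    IsSmoothField (I := I) (mulInvariantVectorField v : ∀ g : K, TangentSpace I g) := by
  let fg : K → TangentBundle I K := fun g ↦ TotalSpace.mk' E g 0
  have sfg : ContMDiff I I.tangent ∞ fg := contMDiff_zeroSection _ _
  let fv : K → TangentBundle I K := fun g ↦ TotalSpace.mk' E 1 v
  have sfv : ContMDiff I I.tangent ∞ fv := contMDiff_const
  let F₁ : K → (TangentBundle I K × TangentBundle I K) := fun g ↦ (fg g, fv g)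
  have S₁ : ContMDiff I (I.tangent.prod I.tangent) ∞ F₁ := sfg.prodMk sfv
  let F₂ : (TangentBundle I K × TangentBundle I K) → TangentBundle (I.prod I) (K × K) :=
    (equivTangentBundleProd I K I K).symm
  have S₂ : ContMDiff (I.tangent.prod I.tangent) (I.prod I).tangent ∞ F₂ :=
    contMDiff_equivTangentBundleProd_symm
  let F₃ : TangentBundle (I.prod I) (K × K) → TangentBundle I K :=
    tangentMap (I.prod I) I (fun (p : K × K) ↦ p.1 * p.2)
  have S₃ : ContMDiff (I.prod I).tangent I.tangent ∞ F₃ :=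
    ContMDiff.contMDiff_tangentMap (n := ∞) (contMDiff_mul I ∞) (m := ∞) le_rfl
  let S := (S₃.comp S₂).comp S₁
  unfold IsSmoothField
  convert! S with g
  · simp [F₁, F₂, F₃, fg, fv]
  · simp only [Function.comp_apply, tangentMap, F₃, F₂, F₁, fg, fv]
    rw [mfderiv_prod_eq_add_apply ((contMDiff_mul I ∞).mdifferentiableAt (by simp))]
    change mfderiv I I (fun z ↦ g * z) 1 v =
      mfderiv I I (fun z ↦ z * (1 : K)) g 0 + mfderiv I I (fun z ↦ g * z) 1 v
    rw [map_zero, zero_add]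

theorem mvfderiv_mulInvariantVectorField {F : K →* A} (hF : ContMDiff I 𝓘(ℝ, A) ∞ F)
    (v : GroupLieAlgebra I K) (g : K) :
    mvfderiv I F g (mulInvariantVectorField v g) = F g * mvfderiv I F 1 v := by
  have hd (y : K) := (hF y).mdifferentiableAt (by simp : (∞ : WithTop ℕ∞) ≠ 0)
  have h1 : MDifferentiableAt I I (g * ·) (1 : K) :=
    (contMDiff_mul_left (n := ∞)).contMDiffAt.mdifferentiableAt (by simp)
  have h := mfderiv_comp_of_eq (hd g) h1 (mul_one g)
  have e : (F ∘ (g * ·) : K → A) = fun y ↦ F g * F y := by ext y; simp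
  have h2 := mvfderiv_clm_comp (ContinuousLinearMap.mul ℝ A (F g)) (hd 1) v
  have h3 : mvfderiv I (fun y ↦ F g * F y) 1 v = mvfderiv I F g (mulInvariantVectorField v g) := by
    have key (y : K) (hy : y = g) :
        (mvfderiv I F y : E →L[ℝ] A) = mvfderiv I F g := by subst hy; rfl
    rw [← e]
    exact (congrArg (fun T ↦ T v) h).trans (congrArg (fun T : E →L[ℝ] A ↦
      T (mulInvariantVectorField v g)) (key (g * 1) (mul_one g)))
  rw [← h3]
  exact h2

theorem isSmoothForm_maurerCartan {F : K →* A} (hF : ContMDiff I 𝓘(ℝ, A) ∞ F) :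
    IsSmoothForm (maurerCartan I F) :=
  isSmoothForm_clm_comp_mvfderiv hF
    ((ContinuousLinearMap.mul ℝ A).contDiff.contMDiff.comp (hF.comp (contMDiff_inv I ∞)))

theorem maurerCartan_mulInvariantVectorField {F : K →* A} (hF : ContMDiff I 𝓘(ℝ, A) ∞ F)
    (v : GroupLieAlgebra I K) (g : K) :
    maurerCartan I F g (mulInvariantVectorField v g) = maurerCartan I F 1 v := by
  simp [maurerCartan, mvfderiv_mulInvariantVectorField hF, ← mul_assoc, ← map_mul]

/-- The Maurer-Cartan equation for `θ = F⁻¹ dF`. Differentiating `Y F = F θ(Y)` along `X` gives `F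
(θ(X) θ(Y) + X θ(Y))`; antisymmetrizing and using that brackets are commutators of derivations gives
the formula. The vector `v` supplies the nowhere vanishing field that the derivation property needs.
-/
theorem maurerCartan_mlieBracket {F : K →* A} (hF : ContMDiff I 𝓘(ℝ, A) ∞ F)
    [CompleteSpace E] {v : GroupLieAlgebra I K} (hv : maurerCartan I F 1 v ≠ 0)
    {X Y : ∀ x : K, TangentSpace I x}
    (hX : IsSmoothField X) (hY : IsSmoothField Y) (g : K) :
    maurerCartan I F g (mlieBracket I X Y g) =
      mvfderiv I (fun h ↦ maurerCartan I F h (Y h)) g (X g) -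
      mvfderiv I (fun h ↦ maurerCartan I F h (X h)) g (Y g) +
      (maurerCartan I F g (X g) * maurerCartan I F g (Y g) -
        maurerCartan I F g (Y g) * maurerCartan I F g (X g)) := by
  have hd (y : K) := (hF y).mdifferentiableAt (by simp : (∞ : WithTop ℕ∞) ≠ 0)
  have hmd {W : ∀ x : K, TangentSpace I x} (hW : IsSmoothField W) :=
    ((hW.apply_hom (isSmoothForm_maurerCartan hF)) g).mdifferentiableAt
      (by simp : (∞ : WithTop ℕ∞) ≠ 0)
  have hb := mvfderiv_mlieBracket hF hX hY (isSmoothField_mulInvariantVectorField v) (x := g)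
    (fun h ↦ hv (by rw [← maurerCartan_mulInvariantVectorField hF v g, h, map_zero]))
  have e1 {W W' : ∀ x : K, TangentSpace I x} (hW : IsSmoothField W) (hW' : IsSmoothField W') :
      F g⁻¹ * mvfderiv I (fun y ↦ mvfderiv I F y (W y)) g (W' g) =
      mvfderiv I (fun h ↦ maurerCartan I F h (W h)) g (W' g) +
      maurerCartan I F g (W' g) * maurerCartan I F g (W g) := by
    simp only [mvfderiv_eq_mul_maurerCartan F _ (W _)]
    rw [mvfderiv_mul_algebra (hd g) (hmd hW), mvfderiv_eq_mul_maurerCartan, mul_add, ← mul_assoc,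
      ← mul_assoc, ← mul_assoc, ← map_mul]
    simp
  change F g⁻¹ * mvfderiv I F g _ = _
  rw [hb, mul_sub, e1 hY hX, e1 hX hY]
  abel

end LieGroup

/-! ### Imaginary quaternions and the Maurer-Cartan form of the three-sphere -/

/-- The vector space `ℝ³`, identified with the imaginary quaternions by `halfQuaternion`. -/
abbrev R3 : Type := Fin 3 → ℝ

/-- The map `u ↦ (u₀ i + u₁ j + u₂ k) / 2`, which carries the cross product to the commutator. -/
def halfQuaternion (u : R3) : ℍ[ℝ] := ⟨0, u 0 / 2, u 1 / 2, u 2 / 2⟩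

@[simp] theorem halfQuaternion_re (u : R3) : (halfQuaternion u).re = 0 := rfl
@[simp] theorem halfQuaternion_imI (u : R3) : (halfQuaternion u).imI = u 0 / 2 := rfl
@[simp] theorem halfQuaternion_imJ (u : R3) : (halfQuaternion u).imJ = u 1 / 2 := rfl
@[simp] theorem halfQuaternion_imK (u : R3) : (halfQuaternion u).imK = u 2 / 2 := rfl

/-- Twice the imaginary part of a quaternion. -/
def twiceIm : ℍ[ℝ] →L[ℝ] R3 :=
  LinearMap.toContinuousLinearMap
  { toFun := fun q ↦ ![2 * q.imI, 2 * q.imJ, 2 * q.imK]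
    map_add' := fun u v ↦ by ext i; fin_cases i <;> simp <;> ring
    map_smul' := fun c u ↦ by ext i; fin_cases i <;> simp <;> ring }

theorem twiceIm_apply (q : ℍ[ℝ]) : twiceIm q = ![2 * q.imI, 2 * q.imJ, 2 * q.imK] := rfl

theorem halfQuaternion_twiceIm {q : ℍ[ℝ]} (hq : q.re = 0) : halfQuaternion (twiceIm q) = q := by
  ext <;> simp [twiceIm_apply, hq]

theorem twiceIm_halfQuaternion (u : R3) : twiceIm (halfQuaternion u) = u := by
  ext i; fin_cases i <;> simp [twiceIm_apply] <;> ring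

theorem halfQuaternion_commutator (u v : R3) :
    halfQuaternion u * halfQuaternion v - halfQuaternion v * halfQuaternion u =
      halfQuaternion (u ⨯₃ v) := by
  ext <;> simp [cross_apply] <;> ring

/-- The inclusion of the unit quaternions into the quaternions. -/
def S3.coeHom : S3 →* ℍ[ℝ] where
  toFun := (↑)
  map_one' := rfl
  map_mul' _ _ := rfl

theorem S3.coeHom_inv (x : S3) : S3.coeHom x⁻¹ = star (x : ℍ[ℝ]) := by
  change (x : ℍ[ℝ])⁻¹ = _
  rw [Quaternion.inv_def, Quaternion.normSq_eq_norm_mul_self, norm_eq_of_mem_sphere x]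
  simp

theorem S3.contMDiff_coeHom : ContMDiff (𝓡 3) 𝓘(ℝ, ℍ[ℝ]) ∞ S3.coeHom := contMDiff_coe_sphere

theorem S3.injective_maurerCartan (x : S3) :
    Function.Injective (maurerCartan (𝓡 3) S3.coeHom x) := by
  intro v w h
  apply injective_mvfderiv_subtypeVal_sphere (n := 3) x
  exact (mvfderiv_eq_mul_maurerCartan S3.coeHom x v).trans
    ((congrArg (fun q ↦ S3.coeHom x * q) h).trans
      (mvfderiv_eq_mul_maurerCartan S3.coeHom x w).symm)

/-- A tangent vector `v` at `x` is orthogonal to `x`, and the real part of `x⁻¹ v = x̄ v` is the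
inner product of `x` and `v`. -/
theorem S3.re_maurerCartan (x : S3) (v : TangentSpace (𝓡 3) x) :
    (maurerCartan (𝓡 3) S3.coeHom x v).re = 0 := by
  have h : mvfderiv (𝓡 3) S3.coeHom x v ∈ (ℝ ∙ (x : ℍ[ℝ]))ᗮ := by
    rw [← range_mvfderiv_subtypeVal (n := 3) x]
    exact ⟨v, rfl⟩
  rw [Submodule.mem_orthogonal_singleton_iff_inner_right, Quaternion.inner_def] at h
  have aux (a b : ℍ[ℝ]) (hab : (a * star b).re = 0) : (star a * b).re = 0 := by
    simp at hab ⊢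
    linarith
  have e := aux _ _ h
  rwa [← S3.coeHom_inv] at e

section Comp
variable {E : Type*} [NormedAddCommGroup E] [NormedSpace ℝ E]
  {H : Type*} [TopologicalSpace H] {I : ModelWithCorners ℝ E H}
  {K : Type*} [TopologicalSpace K] [ChartedSpace H K]
  {A : Type*} [NormedAddCommGroup A] [NormedSpace ℝ A]
  {E' : Type*} [NormedAddCommGroup E'] [NormedSpace ℝ E']
  {H' : Type*} [TopologicalSpace H'] {I' : ModelWithCorners ℝ E' H'}
  {K' : Type*} [TopologicalSpace K'] [ChartedSpace H' K']

theorem mvfderiv_comp_mfderiv {f : K → A} {h : K' → K} (x : K')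
    (hf : MDifferentiableAt I 𝓘(ℝ, A) f (h x)) (hh : MDifferentiableAt I' I h x)
    (v : TangentSpace I' x) :
    mvfderiv I' (fun y ↦ f (h y)) x v = mvfderiv I f (h x) (mfderiv I' I h x v) :=
  congrArg (fun T ↦ T v) (mfderiv_comp x hf hh)

end Comp

section Prod
variable {E : Type*} [NormedAddCommGroup E] [NormedSpace ℝ E]
  {H : Type*} [TopologicalSpace H] {I : ModelWithCorners ℝ E H}
  {K : Type*} [TopologicalSpace K] [ChartedSpace H K] [Group K]
  {A : Type*} [NormedRing A] [NormedAlgebra ℝ A]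
  {E' : Type*} [NormedAddCommGroup E'] [NormedSpace ℝ E']
  {H' : Type*} [TopologicalSpace H'] {I' : ModelWithCorners ℝ E' H'}
  {K' : Type*} [TopologicalSpace K'] [ChartedSpace H' K'] [Group K']
  {A' : Type*} [NormedRing A'] [NormedAlgebra ℝ A']

theorem contMDiff_prodMap {F : K →* A} {F' : K' →* A'} (hF : ContMDiff I 𝓘(ℝ, A) ∞ F)
    (hF' : ContMDiff I' 𝓘(ℝ, A') ∞ F') :
    ContMDiff (I.prod I') 𝓘(ℝ, A × A') ∞ (F.prodMap F') :=
  (hF.comp contMDiff_fst).prodMk_space (hF'.comp contMDiff_snd)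

theorem maurerCartan_prodMap {F : K →* A} {F' : K' →* A'} (hF : ContMDiff I 𝓘(ℝ, A) ∞ F)
    (hF' : ContMDiff I' 𝓘(ℝ, A') ∞ F') (p : K × K') (v : TangentSpace (I.prod I') p) :
    maurerCartan (I.prod I') (F.prodMap F') p v =
      (maurerCartan I F p.1 v.1, maurerCartan I' F' p.2 v.2) := by
  have hd := (contMDiff_prodMap hF hF' p).mdifferentiableAt (by simp : (∞ : WithTop ℕ∞) ≠ 0)
  have h1 := (hF p.1).mdifferentiableAt (by simp : (∞ : WithTop ℕ∞) ≠ 0)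
  have h2 := (hF' p.2).mdifferentiableAt (by simp : (∞ : WithTop ℕ∞) ≠ 0)
  have e1 : (mvfderiv (I.prod I') (F.prodMap F') p v).1 = mvfderiv I F p.1 v.1 := by
    refine (mvfderiv_clm_comp (ContinuousLinearMap.fst ℝ A A') hd v).symm.trans ?_
    refine (mvfderiv_comp_mfderiv (h := Prod.fst) p h1 mdifferentiableAt_fst v).trans ?_
    rw [mfderiv_fst]
    rfl
  have e2 : (mvfderiv (I.prod I') (F.prodMap F') p v).2 = mvfderiv I' F' p.2 v.2 := by
    refine (mvfderiv_clm_comp (ContinuousLinearMap.snd ℝ A A') hd v).symm.trans ?_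
    refine (mvfderiv_comp_mfderiv (h := Prod.snd) p h2 mdifferentiableAt_snd v).trans ?_
    rw [mfderiv_snd]
    rfl
  exact Prod.ext (congrArg (fun q ↦ F p.1⁻¹ * q) e1) (congrArg (fun q ↦ F' p.2⁻¹ * q) e2)

end Prod

/-! ### The left-invariant frame of the product of two three-spheres -/

/-- The vector space `ℝ³ × ℝ³`, the Lie algebra of `S³ × S³`. -/
abbrev V : Type := R3 × R3

/-- The inclusion of `S³ × S³` into `ℍ × ℍ`. -/
def coeM : M →* ℍ[ℝ] × ℍ[ℝ] := S3.coeHom.prodMap S3.coeHom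

theorem contMDiff_coeM : ContMDiff IM 𝓘(ℝ, ℍ[ℝ] × ℍ[ℝ]) ∞ coeM :=
  contMDiff_prodMap S3.contMDiff_coeHom S3.contMDiff_coeHom

instance (p : M) : FiniteDimensional ℝ (TangentSpace IM p) :=
  inferInstanceAs (FiniteDimensional ℝ (EuclideanSpace ℝ (Fin 3) × EuclideanSpace ℝ (Fin 3)))

/-- The left-invariant coframe of `S³ × S³`. -/
def coframe (p : M) : TangentSpace IM p →L[ℝ] V :=
  (twiceIm.prodMap twiceIm).comp (maurerCartan IM coeM p)

/-- The inclusion of the Lie algebra of `S³ × S³` into `ℍ × ℍ`. -/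
def incl (a : V) : ℍ[ℝ] × ℍ[ℝ] := (halfQuaternion a.1, halfQuaternion a.2)

theorem maurerCartan_coeM (p : M) (v : TangentSpace IM p) :
    maurerCartan IM coeM p v = (maurerCartan (𝓡 3) S3.coeHom p.1 v.1,
      maurerCartan (𝓡 3) S3.coeHom p.2 v.2) :=
  maurerCartan_prodMap S3.contMDiff_coeHom S3.contMDiff_coeHom p v

theorem incl_coframe (p : M) (v : TangentSpace IM p) :
    incl (coframe p v) = maurerCartan IM coeM p v := by
  rw [maurerCartan_coeM]
  refine Prod.ext ?_ ?_
  · refine Eq.trans ?_ (halfQuaternion_twiceIm (S3.re_maurerCartan p.1 v.1))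
    exact congrArg (fun q : ℍ[ℝ] × ℍ[ℝ] ↦ halfQuaternion (twiceIm q.1)) (maurerCartan_coeM p v)
  · refine Eq.trans ?_ (halfQuaternion_twiceIm (S3.re_maurerCartan p.2 v.2))
    exact congrArg (fun q : ℍ[ℝ] × ℍ[ℝ] ↦ halfQuaternion (twiceIm q.2)) (maurerCartan_coeM p v)

theorem injective_coframe (p : M) : Function.Injective (coframe p) := by
  intro v w h
  have h' := congrArg incl h
  rw [incl_coframe, incl_coframe, maurerCartan_coeM, maurerCartan_coeM, Prod.mk.injEq] at h'
  exact Prod.ext (S3.injective_maurerCartan p.1 h'.1) (S3.injective_maurerCartan p.2 h'.2)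

/-- The coframe as an isomorphism. -/
def coframeEquiv (p : M) : TangentSpace IM p ≃ₗ[ℝ] V :=
  LinearEquiv.ofInjectiveOfFinrankEq (coframe p).toLinearMap (injective_coframe p) (by
    change Module.finrank ℝ (EuclideanSpace ℝ (Fin 3) × EuclideanSpace ℝ (Fin 3)) = _
    simp)

/-- The frame of left-invariant vector fields. -/
def frame (p : M) : V →L[ℝ] TangentSpace IM p :=
  LinearMap.toContinuousLinearMap (coframeEquiv p).symm.toLinearMap

@[simp] theorem coframe_frame (p : M) (a : V) : coframe p (frame p a) = a :=
  (coframeEquiv p).apply_symm_apply a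

@[simp] theorem frame_coframe (p : M) (v : TangentSpace IM p) : frame p (coframe p v) = v :=
  (coframeEquiv p).symm_apply_apply v

theorem isSmoothForm_coframe : IsSmoothForm coframe :=
  isSmoothForm_clm_comp_mvfderiv (A := fun p ↦ (twiceIm.prodMap twiceIm).comp
    (ContinuousLinearMap.mul ℝ (ℍ[ℝ] × ℍ[ℝ]) (coeM p⁻¹))) contMDiff_coeM
    (contMDiff_const.clm_comp ((ContinuousLinearMap.mul ℝ (ℍ[ℝ] × ℍ[ℝ])).contDiff.contMDiff.comp
      (contMDiff_coeM.comp (contMDiff_inv IM ∞))))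

theorem IsSmoothField.coframe {X : ∀ p : M, TangentSpace IM p} (hX : IsSmoothField X) :
    ContMDiff IM 𝓘(ℝ, V) ∞ fun p ↦ coframe p (X p) :=
  hX.apply_hom isSmoothForm_coframe

theorem mulInvariantVectorField_frame (a : V) (p : M) :
    mulInvariantVectorField (frame 1 a : GroupLieAlgebra IM M) p = frame p a := by
  apply injective_coframe
  rw [coframe_frame]
  have h := maurerCartan_mulInvariantVectorField contMDiff_coeM (frame 1 a : GroupLieAlgebra IM M) p
  exact (congrArg (twiceIm.prodMap twiceIm) h).trans (coframe_frame 1 a)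

theorem isSmoothField_frame_const (a : V) : IsSmoothField (fun p : M ↦ frame p a) := by
  have h := isSmoothField_mulInvariantVectorField (frame 1 a : GroupLieAlgebra IM M)
  exact (funext (mulInvariantVectorField_frame a)) ▸ h

/-- Expanding `f` in a basis of `V` reduces this to constant coefficients, where the field is
left-invariant. -/
theorem isSmoothField_frame {f : M → V} (hf : ContMDiff IM 𝓘(ℝ, V) ∞ f) :
    IsSmoothField (fun p ↦ frame p (f p)) := by
  let b := Module.finBasis ℝ V
  have h (k) : IsSmoothField ((fun p ↦ b.coord k (f p)) • fun p : M ↦ frame p (b k)) :=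
    ContMDiff.smul_section
      ((LinearMap.toContinuousLinearMap (b.coord k)).contDiff.contMDiff.comp hf)
      (isSmoothField_frame_const (b k))
  have := ContMDiff.sum_section (s := Finset.univ) (fun k _ ↦ h k)
  refine this.congr fun p ↦ ?_
  have e : frame p (f p) = ∑ k, b.coord k (f p) • frame p (b k) := by
    conv_lhs => rw [← b.sum_repr (f p), map_sum]
    simp only [map_smul]
    rfl
  exact congrArg (fun v ↦ (⟨p, v⟩ : TangentBundle IM M)) e

theorem isSmoothField_iff {X : ∀ p : M, TangentSpace IM p} :
    IsSmoothField X ↔ ContMDiff IM 𝓘(ℝ, V) ∞ fun p ↦ coframe p (X p) :=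
  ⟨fun h ↦ h.coframe, fun h ↦ by simpa using isSmoothField_frame h⟩

/-- The Lie bracket of the Lie algebra of `S³ × S³`. -/
def br (a b : V) : V := (a.1 ⨯₃ b.1, a.2 ⨯₃ b.2)

theorem coframe_mlieBracket {X Y : ∀ p : M, TangentSpace IM p} (hX : IsSmoothField X)
    (hY : IsSmoothField Y) (p : M) :
    coframe p (mlieBracket IM X Y p) =
      mvfderiv IM (fun q ↦ coframe q (Y q)) p (X p) -
      mvfderiv IM (fun q ↦ coframe q (X q)) p (Y p) +
      br (coframe p (X p)) (coframe p (Y p)) := by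
  obtain ⟨a, ha⟩ := exists_ne (0 : V)
  have hne : maurerCartan IM coeM 1 (frame 1 a) ≠ 0 := by
    intro h
    apply ha
    rw [← coframe_frame 1 a]
    exact (congrArg (twiceIm.prodMap twiceIm) h).trans (map_zero _)
  have hmd {W : ∀ x : M, TangentSpace IM x} (hW : IsSmoothField W) :=
    ((hW.apply_hom (isSmoothForm_maurerCartan contMDiff_coeM)) p).mdifferentiableAt
      (by simp : (∞ : WithTop ℕ∞) ≠ 0)
  have h := congrArg (twiceIm.prodMap twiceIm) (maurerCartan_mlieBracket contMDiff_coeM hne hX hY p)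
  rw [map_add, map_sub, ← mvfderiv_clm_comp _ (hmd hX), ← mvfderiv_clm_comp _ (hmd hY)] at h
  refine h.trans (congrArg₂ _ rfl ?_)
  rw [← incl_coframe, ← incl_coframe]
  refine Prod.ext ?_ ?_
  · exact (congrArg twiceIm (halfQuaternion_commutator _ _)).trans (twiceIm_halfQuaternion _)
  · exact (congrArg twiceIm (halfQuaternion_commutator _ _)).trans (twiceIm_halfQuaternion _)

theorem mvfderiv_mlieBracket_M {F : Type*} [NormedAddCommGroup F] [NormedSpace ℝ F] {f : M → F}
    (hf : ContMDiff IM 𝓘(ℝ, F) ∞ f) {X Y : ∀ p : M, TangentSpace IM p} (hX : IsSmoothField X)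
    (hY : IsSmoothField Y) (p : M) :
    mvfderiv IM f p (mlieBracket IM X Y p) =
      mvfderiv IM (fun y ↦ mvfderiv IM f y (Y y)) p (X p) -
      mvfderiv IM (fun y ↦ mvfderiv IM f y (X y)) p (Y p) := by
  obtain ⟨a, ha⟩ := exists_ne (0 : V)
  refine mvfderiv_mlieBracket hf hX hY (isSmoothField_frame_const a) fun h ↦ ha ?_
  rw [← coframe_frame p a, h, map_zero]

/-! ### Algebra on left-invariant fields: metric, connection, complex structure, curvature -/

/-- Bilinear maps on `V` as continuous bilinear maps. -/
def mkCLM₂ {W : Type*} [NormedAddCommGroup W] [NormedSpace ℝ W] [FiniteDimensional ℝ W]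
    (f : V →ₗ[ℝ] V →ₗ[ℝ] W) : V →L[ℝ] V →L[ℝ] W :=
  LinearMap.toContinuousLinearMap (LinearMap.toContinuousLinearMap.toLinearMap.comp f)

/-- The inner product on the Lie algebra of `S³ × S³`. -/
def ip : V →L[ℝ] V →L[ℝ] ℝ := mkCLM₂ (LinearMap.mk₂ ℝ (fun a b ↦
  -- The lift of `(x, y)` to `𝔭` is `(2x - y, 2y - x, -x - y)/3`; twice the sum of the three squared
  -- lengths is `(4/3)(|x|² + |y|² - x·y)`, and this is its polarization.
  2 / 3 * (2 * (a.1 ⬝ᵥ b.1) + 2 * (a.2 ⬝ᵥ b.2) - a.1 ⬝ᵥ b.2 - a.2 ⬝ᵥ b.1))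
  (fun a b c ↦ by simp; ring) (fun a b c ↦ by simp; ring) (fun a b c ↦ by simp; ring)
  (fun a b c ↦ by simp; ring))

/-- The Levi-Civita connection on left-invariant vector fields. -/
def lc : V →L[ℝ] V →L[ℝ] V := mkCLM₂ (LinearMap.mk₂ ℝ (fun a b ↦
    -- Half the bracket plus a term symmetric in `a` and `b`; the coefficient `1/6` is what makes
    -- `lc a` skew for `ip`.
    ((1 / 2 : ℝ) • (a.1 ⨯₃ b.1) - (1 / 6 : ℝ) • (a.1 ⨯₃ b.2 - a.2 ⨯₃ b.1),
     (1 / 2 : ℝ) • (a.2 ⨯₃ b.2) + (1 / 6 : ℝ) • (a.1 ⨯₃ b.2 - a.2 ⨯₃ b.1)))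
  (fun a b c ↦ by simp; constructor <;> module) (fun a b c ↦ by simp; constructor <;> module)
  (fun a b c ↦ by simp; constructor <;> module)
  (fun a b c ↦ by simp; constructor <;> module))

theorem ip_apply (a b : V) : ip a b =
    2 / 3 * (2 * (a.1 ⬝ᵥ b.1) + 2 * (a.2 ⬝ᵥ b.2) - a.1 ⬝ᵥ b.2 - a.2 ⬝ᵥ b.1) := rfl

theorem lc_apply (a b : V) : lc a b =
    ((1 / 2 : ℝ) • (a.1 ⨯₃ b.1) - (1 / 6 : ℝ) • (a.1 ⨯₃ b.2 - a.2 ⨯₃ b.1),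
     (1 / 2 : ℝ) • (a.2 ⨯₃ b.2) + (1 / 6 : ℝ) • (a.1 ⨯₃ b.2 - a.2 ⨯₃ b.1)) := rfl

theorem ip_symm (a b : V) : ip a b = ip b a := by
  simp only [ip_apply, dotProduct_comm b.1, dotProduct_comm b.2]
  ring

theorem ip_pos {a : V} (ha : a ≠ 0) : 0 < ip a a := by
  -- The sum and difference coordinates diagonalize `ip`; the same coordinates later diagonalize the
  -- curvature operator.
  have h1 : ip a a = (1 / 3) * ((a.1 + a.2) ⬝ᵥ (a.1 + a.2)) + (a.1 - a.2) ⬝ᵥ (a.1 - a.2) := by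
    simp only [ip_apply, dotProduct, Fin.sum_univ_three, Pi.add_apply, Pi.sub_apply]
    ring
  have h2 (u : R3) : 0 ≤ u ⬝ᵥ u := Finset.sum_nonneg fun i _ ↦ mul_self_nonneg _
  rw [h1]
  by_contra hle
  have e1 := dotProduct_self_eq_zero.1
    (le_antisymm (by linarith [h2 (a.1 + a.2), h2 (a.1 - a.2)]) (h2 (a.1 + a.2)))
  have e2 := dotProduct_self_eq_zero.1
    (le_antisymm (by linarith [h2 (a.1 + a.2), h2 (a.1 - a.2)]) (h2 (a.1 - a.2)))
  apply ha
  ext i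
  · have := congrFun e1 i; have := congrFun e2 i
    simp at *; linarith
  · have := congrFun e1 i; have := congrFun e2 i
    simp at *; linarith

theorem ip_ext {a b : V} (h : ∀ c, ip a c = ip b c) : a = b := by
  by_contra hne
  have := ip_pos (sub_ne_zero.2 hne)
  rw [map_sub ip a b] at this
  simp only [sub_apply, h, sub_self, lt_self_iff_false] at this

theorem br_apply (a b : V) : br a b = (a.1 ⨯₃ b.1, a.2 ⨯₃ b.2) := rfl

theorem lc_sub (a b : V) : lc a b - lc b a = br a b := by
  simp only [lc_apply, br_apply]
  ext i <;> fin_cases i <;> simp [cross_apply] <;> ring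

/-- On left-invariant fields inner products are constant, so metric compatibility says that `lc a`
is skew. With `lc_sub`, which is vanishing torsion, this characterizes the Levi-Civita connection.
-/
theorem lc_metric (a b c : V) : ip (lc a b) c + ip b (lc a c) = 0 := by
  simp [lc_apply, ip_apply, cross_apply, dotProduct, Fin.sum_univ_three]
  ring

/-- The almost complex structure on left-invariant vector fields. -/
def jj : V →L[ℝ] V := LinearMap.toContinuousLinearMap
  { toFun := fun a ↦
      ((Real.sqrt 3)⁻¹ • (a.1 - (2 : ℝ) • a.2), (Real.sqrt 3)⁻¹ • ((2 : ℝ) • a.1 - a.2))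
    map_add' := fun a b ↦ by simp; constructor <;> module
    map_smul' := fun c a ↦ by simp; constructor <;> module }

theorem jj_apply (a : V) : jj a =
    ((Real.sqrt 3)⁻¹ • (a.1 - (2 : ℝ) • a.2), (Real.sqrt 3)⁻¹ • ((2 : ℝ) • a.1 - a.2)) := rfl

theorem inv_sqrt_three_sq : (Real.sqrt 3)⁻¹ * (Real.sqrt 3)⁻¹ = 1 / 3 := by
  rw [← mul_inv, Real.mul_self_sqrt (by norm_num)]; norm_num

/-- The map `σ (x, y) = (-y, x - y)` is the cyclic permutation `(a, b, c) ↦ (c, a, b)` seen through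
`(a - c, b - c)`. It satisfies `σ² + σ + 1 = 0`, and `jj = (2σ + 1)/√3`. -/
theorem jj_jj (a : V) : jj (jj a) = -a := by
  simp only [jj_apply]
  have := inv_sqrt_three_sq
  ext i <;> simp
  · linear_combination (-3 * a.1 i) * this
  · linear_combination (-3 * a.2 i) * this

theorem ip_jj (a b : V) : ip (jj a) (jj b) = ip a b := by
  have := inv_sqrt_three_sq
  simp [jj_apply, ip_apply]
  linear_combination
    (3 * (2 * (a.1 ⬝ᵥ b.1) + 2 * (a.2 ⬝ᵥ b.2) - a.1 ⬝ᵥ b.2 - a.2 ⬝ᵥ b.1)) * this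

theorem lc_jj (a : V) : lc a (jj a) = jj (lc a a) := by
  simp only [jj_apply, lc_apply]
  ext i <;> fin_cases i <;> simp [cross_apply] <;> ring

theorem exists_lc_jj_ne : ∃ a b, lc a (jj b) ≠ jj (lc a b) := by
  refine ⟨(![1, 0, 0], 0), (![0, 1, 0], 0), fun h ↦ ?_⟩
  have := congrFun (congrArg Prod.fst h) 2
  simp [jj_apply, lc_apply, cross_apply] at this
  field_simp at this
  norm_num at this

/-- The curvature tensor on left-invariant vector fields. -/
def curv : V →ₗ[ℝ] V →ₗ[ℝ] V →ₗ[ℝ] V := LinearMap.mk₂ ℝ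
  (fun a b ↦ ((lc a).comp (lc b) - (lc b).comp (lc a) - lc (br a b)).toLinearMap)
  (fun a a' b ↦ by
    have : br (a + a') b = br a b + br a' b := by simp [br_apply]
    refine LinearMap.ext fun c ↦ ?_; simp [this]; abel)
  (fun r a b ↦ by
    have : br (r • a) b = r • br a b := by simp [br_apply]
    refine LinearMap.ext fun c ↦ ?_; simp [this, smul_sub])
  (fun a b b' ↦ by
    have : br a (b + b') = br a b + br a b' := by simp [br_apply]
    refine LinearMap.ext fun c ↦ ?_; simp [this]; abel)
  (fun r a b ↦ by
    have : br a (r • b) = r • br a b := by simp [br_apply]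
    refine LinearMap.ext fun c ↦ ?_; simp [this, smul_sub])

theorem curv_apply (a b c : V) :
    curv a b c = lc a (lc b c) - lc b (lc a c) - lc (br a b) c := rfl

/-- The covariant derivative of the curvature tensor on left-invariant vector fields. -/
def dcurv (w a b c : V) : V :=
  lc w (curv a b c) - curv (lc w a) b c - curv a (lc w b) c - curv a b (lc w c)

theorem exists_dcurv_ne : ∃ w a b c, dcurv w a b c ≠ 0 := by
  -- The last argument is taken in the other factor; the third coordinate of the first factor is
  -- already nonzero.
  refine ⟨(![1, 0, 0], 0), (![1, 0, 0], 0), (![0, 1, 0], 0), (0, ![1, 0, 0]), fun h ↦ ?_⟩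
  have := congrFun (congrArg Prod.fst h) 2
  simp [dcurv, curv_apply, lc_apply, br_apply, cross_apply] at this
  norm_num at this

theorem trace_curv (b c : V) :
    LinearMap.trace ℝ V ((curv.flip b).flip c) = 5 / 12 * ip b c := by
  rw [LinearMap.trace_eq_matrix_trace ℝ ((Pi.basisFun ℝ (Fin 3)).prod (Pi.basisFun ℝ (Fin 3)))]
  simp [Matrix.trace, LinearMap.toMatrix_apply, Fin.sum_univ_three, curv_apply, lc_apply, br_apply,
    cross_apply, ip_apply, dotProduct, Pi.basisFun_apply]
  ring

/-! ### The invariant metric as a smooth pullback of the inner product -/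

set_option synthInstance.maxHeartbeats 200000 in
theorem contDiff_flip {E V : Type*} [NormedAddCommGroup E] [NormedSpace ℝ E]
    [NormedAddCommGroup V] [NormedSpace ℝ V] :
    ContDiff ℝ ∞ fun β : E →L[ℝ] V →L[ℝ] ℝ ↦ β.flip := by
  have h : IsBoundedLinearMap ℝ fun β : E →L[ℝ] V →L[ℝ] ℝ ↦ β.flip :=
    ⟨⟨fun _ _ ↦ rfl, fun _ _ ↦ rfl⟩, 1, one_pos, fun β ↦ by
      rw [one_mul, ContinuousLinearMap.opNorm_flip]⟩
  exact h.contDiff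

set_option synthInstance.maxHeartbeats 200000 in
theorem contDiff_bilinearComp {E V : Type*} [NormedAddCommGroup E] [NormedSpace ℝ E]
    [NormedAddCommGroup V] [NormedSpace ℝ V] (β : V →L[ℝ] V →L[ℝ] ℝ) :
    ContDiff ℝ ∞ fun L : E →L[ℝ] V ↦ β.bilinearComp L L := by
  have h1 : ContDiff ℝ ∞ fun L : E →L[ℝ] V ↦ β.comp L := contDiff_const.clm_comp contDiff_id
  have h2 : ContDiff ℝ ∞ fun L : E →L[ℝ] V ↦ (β.comp L).flip := contDiff_flip.comp h1
  have h3 : ContDiff ℝ ∞ fun L : E →L[ℝ] V ↦ (β.comp L).flip.comp L := h2.clm_comp contDiff_id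
  exact contDiff_flip.comp h3

section
variable {E : Type*} [NormedAddCommGroup E] [NormedSpace ℝ E]
  {H : Type*} [TopologicalSpace H] {I : ModelWithCorners ℝ E H}
  {M : Type*} [TopologicalSpace M] [ChartedSpace H M] [IsManifold I ∞ M]
  {V : Type*} [NormedAddCommGroup V] [NormedSpace ℝ V]

/-- The pullback of a bilinear form. -/
def pullbackForm (β : V →L[ℝ] V →L[ℝ] ℝ) {x : M} (φ : TangentSpace I x →L[ℝ] V) :
    TangentSpace I x →L[ℝ] TangentSpace I x →L[ℝ] ℝ :=
  (ContinuousLinearMap.precomp ℝ φ).comp (β.comp φ)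

/-- In a trivialization the pullback is `L ↦ β(L ·, L ·)` applied to the local expression of `φ`,
and this map is smooth in `L`. -/
theorem IsSmoothForm.contMDiff_pullbackForm {φ : ∀ x : M, TangentSpace I x →L[ℝ] V}
    (hφ : IsSmoothForm φ) (β : V →L[ℝ] V →L[ℝ] ℝ) :
    ContMDiff I (I.prod 𝓘(ℝ, E →L[ℝ] E →L[ℝ] ℝ)) ∞
      (fun x : M ↦ TotalSpace.mk' (E →L[ℝ] E →L[ℝ] ℝ)
        (E := fun x : M ↦ TangentSpace I x →L[ℝ] TangentSpace I x →L[ℝ] ℝ) x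
        (pullbackForm β (φ x))) := by
  intro x₀
  have h := hφ x₀
  rw [contMDiffAt_hom_bundle] at h
  refine (contMDiffAt_hom_bundle _).2 ⟨contMDiffAt_id, ?_⟩
  have hA := h.2
  have h2 := (contDiff_bilinearComp β).contMDiff.contMDiffAt.comp x₀ hA
  refine h2.congr_of_eventuallyEq ?_
  have hB : ∀ᶠ x in nhds x₀, x ∈ (trivializationAt E (TangentSpace I) x₀).baseSet :=
    (trivializationAt E (TangentSpace I) x₀).open_baseSet.mem_nhds
      (FiberBundle.mem_baseSet_trivializationAt' x₀)
  filter_upwards [hB] with x hx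
  ext v w
  refine (inCoordinates_apply_eq₂ hx hx (Set.mem_univ _)).trans ?_
  have e (v : E) : ContinuousLinearMap.inCoordinates E (TangentSpace I) V (Bundle.Trivial M V)
      x₀ x x₀ x (φ x) v = φ x ((trivializationAt E (TangentSpace I) x₀).symm x v) := by
    simp [ContinuousLinearMap.inCoordinates]
    rw [Bundle.Trivialization.symmL_apply _ hx]
  simp [pullbackForm, e]

end

section Bilinear
variable {E : Type*} [NormedAddCommGroup E] [NormedSpace ℝ E]
  {H : Type*} [TopologicalSpace H] {I : ModelWithCorners ℝ E H}
  {M : Type*} [TopologicalSpace M] [ChartedSpace H M]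
  {F : Type*} [NormedAddCommGroup F] [NormedSpace ℝ F]
  {F' : Type*} [NormedAddCommGroup F'] [NormedSpace ℝ F']
  {W : Type*} [NormedAddCommGroup W] [NormedSpace ℝ W]

theorem mvfderiv_bilinear (β : F →L[ℝ] F' →L[ℝ] W) {f : M → F} {h : M → F'} {x : M}
    (hf : MDifferentiableAt I 𝓘(ℝ, F) f x) (hh : MDifferentiableAt I 𝓘(ℝ, F') h x)
    (v : TangentSpace I x) :
    mvfderiv I (fun y ↦ β (f y) (h y)) x v =
      β (mvfderiv I f x v) (h x) + β (f x) (mvfderiv I h x v) := by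
  have hp : MDifferentiableAt I 𝓘(ℝ, F × F') (fun y ↦ (f y, h y)) x := hf.prodMk_space hh
  have hβ := β.isBoundedBilinearMap
  have e := congrArg (fun T ↦ T v) (mfderiv_comp x
    (g := fun q : F × F' ↦ β q.1 q.2) (hβ.differentiableAt (f x, h x)).mdifferentiableAt hp)
  rw [mfderiv_eq_fderiv, hβ.fderiv] at e
  have e1 := mvfderiv_clm_comp (ContinuousLinearMap.fst ℝ F F') hp v
  have e2 := mvfderiv_clm_comp (ContinuousLinearMap.snd ℝ F F') hp v
  refine e.trans ((add_comm _ _).trans ?_)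
  exact congrArg₂ (fun a b ↦ β a (h x) + β (f x) b) e1.symm e2.symm

end Bilinear

/-- The standard homogeneous metric. -/
def metric : SmoothMetric IM M where
  inner p := pullbackForm ip (coframe p)
  symm p v w := ip_symm _ _
  pos p v hv := ip_pos fun h ↦ hv (injective_coframe p (h.trans (map_zero _).symm))
  isVonNBounded p := by
    have hb : Bornology.IsVonNBounded ℝ {a : V | ip a a < 1} := by
      rw [NormedSpace.isVonNBounded_iff]
      -- A crude radius: from `4|x|² ≤ 2|x + y|² + 2|x - y|² ≤ 6 ip(a, a) < 6`, where `a = (x, y)`,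
      -- each coordinate has square below `4`, and likewise for `y`.
      refine (Metric.isBounded_closedBall (x := (0 : V)) (r := 2)).subset fun a ha ↦ ?_
      rw [mem_closedBall_zero_iff]
      have h : ip a a < 1 := ha
      have h1 : ip a a = (1 / 3) * ((a.1 + a.2) ⬝ᵥ (a.1 + a.2)) + (a.1 - a.2) ⬝ᵥ (a.1 - a.2) := by
        simp only [ip_apply, dotProduct, Fin.sum_univ_three, Pi.add_apply, Pi.sub_apply]
        ring
      rw [h1] at h
      simp only [dotProduct, Fin.sum_univ_three, Pi.add_apply, Pi.sub_apply] at h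
      rw [Prod.norm_def, max_le_iff, pi_norm_le_iff_of_nonneg zero_le_two,
        pi_norm_le_iff_of_nonneg zero_le_two]
      constructor <;> intro i <;> rw [Real.norm_eq_abs] <;>
        apply abs_le_of_sq_le_sq _ zero_le_two <;>
        fin_cases i <;> simp <;>
        linarith [mul_self_nonneg (a.1 0 + a.2 0), mul_self_nonneg (a.1 0 - a.2 0),
          mul_self_nonneg (a.1 1 + a.2 1), mul_self_nonneg (a.1 1 - a.2 1),
          mul_self_nonneg (a.1 2 + a.2 2), mul_self_nonneg (a.1 2 - a.2 2), sq_nonneg (a.1 0),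
          sq_nonneg (a.1 1), sq_nonneg (a.1 2), sq_nonneg (a.2 0), sq_nonneg (a.2 1),
          sq_nonneg (a.2 2)]
    refine Bornology.IsVonNBounded.subset ?_ (hb.image (frame p))
    intro v hv
    exact ⟨coframe p v, hv, frame_coframe p v⟩
  contMDiff := isSmoothForm_coframe.contMDiff_pullbackForm ip

theorem metric_inner (p : M) (v w : TangentSpace IM p) :
    metric.inner p v w = ip (coframe p v) (coframe p w) := rfl

/-! ### Levi-Civita connection, curvature tensor, nearly Kähler and Einstein conditions -/

/-- The Levi-Civita connection of the standard homogeneous metric. -/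
def connection : Connection IM M where
  toFun Y p := (frame p).comp (mvfderiv IM (fun q ↦ coframe q (Y q)) p +
    (lc.flip (coframe p (Y p))).comp (coframe p))
  isCovariantDerivativeOnUniv :=
    { add := fun {Y Z p} hY hZ _ ↦ by
        have h := mvfderiv_add (MDifferentiableAt.apply_hom isSmoothForm_coframe hY)
          (MDifferentiableAt.apply_hom isSmoothForm_coframe hZ)
        ext v
        apply injective_coframe p
        have h' := congrArg (fun T ↦ T v) h
        simp [Pi.add_def] at h' ⊢
        rw [h']
        abel
      leibniz := fun {Y f p} hY hf _ ↦ by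
        have h := mvfderiv_smul hf (MDifferentiableAt.apply_hom isSmoothForm_coframe hY)
        ext v
        apply injective_coframe p
        have h' := congrArg (fun T ↦ T v) h
        simp [Pi.smul_def'] at h' ⊢
        rw [h']
        module }

theorem coframe_nabla (X Y : ∀ p : M, TangentSpace IM p) (p : M) :
    coframe p (nabla connection X Y p) =
      mvfderiv IM (fun q ↦ coframe q (Y q)) p (X p) + lc (coframe p (X p)) (coframe p (Y p)) :=
  coframe_frame p _

theorem IsSmoothField.nabla {X Y : ∀ p : M, TangentSpace IM p} (hX : IsSmoothField X)
    (hY : IsSmoothField Y) : IsSmoothField (nabla connection X Y) := by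
  rw [isSmoothField_iff]
  simp only [coframe_nabla]
  exact (hX.mvfderiv hY.coframe).add
    ((lc.contDiff.contMDiff.comp hX.coframe).clm_apply hY.coframe)

theorem IsSmoothField.mdifferentiableAt_coframe {X : ∀ p : M, TangentSpace IM p}
    (hX : IsSmoothField X) (p : M) :
    MDifferentiableAt IM 𝓘(ℝ, V) (fun q ↦ NearlyKahlerS3S3.coframe q (X q)) p :=
  (hX.coframe p).mdifferentiableAt (by simp)

theorem nabla_sub_nabla {X Y : ∀ p : M, TangentSpace IM p} (hX : IsSmoothField X)
    (hY : IsSmoothField Y) (p : M) :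
    NearlyKahlerS3S3.nabla connection X Y p - NearlyKahlerS3S3.nabla connection Y X p =
      mlieBracket IM X Y p := by
  apply injective_coframe p
  rw [map_sub, coframe_nabla, coframe_nabla, coframe_mlieBracket hX hY, ← lc_sub]
  abel

/-- Torsion is tensorial, so tangent vectors may be extended by left-invariant fields. -/
theorem torsion_connection : connection.torsion = 0 := by
  funext p
  ext u v : 2
  have hu := isSmoothField_frame_const (coframe p u)
  have hv := isSmoothField_frame_const (coframe p v)
  have h := connection.torsion_apply (hu.mdifferentiableAt p) (hv.mdifferentiableAt p)
  rw [frame_coframe, frame_coframe] at h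
  have h2 := nabla_sub_nabla hu hv p
  simp only [nabla, frame_coframe] at h2
  refine h.trans ?_
  rw [h2, sub_self]
  rfl

theorem isLeviCivita_connection : IsLeviCivita metric connection := by
  refine ⟨torsion_connection, fun X Y Z hX hY hZ p ↦ ?_⟩
  simp only [metric_inner]
  rw [mvfderiv_bilinear ip (hY.mdifferentiableAt_coframe p) (hZ.mdifferentiableAt_coframe p),
    coframe_nabla, coframe_nabla, map_add, map_add, add_apply]
  linear_combination -lc_metric (coframe p (X p)) (coframe p (Y p)) (coframe p (Z p))

/-- The curvature tensor of the standard homogeneous metric. -/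
def curvatureTensor : CurvatureTensor IM M := fun p ↦
  (curv.compl₁₂ (coframe p).toLinearMap (coframe p).toLinearMap).compr₂
    (coframeEquiv p).symm.conj.toLinearMap

theorem coframe_curvatureTensor (p : M) (u v w : TangentSpace IM p) :
    coframe p (curvatureTensor p u v w) = curv (coframe p u) (coframe p v) (coframe p w) :=
  coframe_frame p _

theorem mvfderiv_coframe_nabla {X Y Z : ∀ p : M, TangentSpace IM p} (hY : IsSmoothField Y)
    (hZ : IsSmoothField Z) (p : M) :
    mvfderiv IM (fun q ↦ coframe q (nabla connection Y Z q)) p (X p) =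
      mvfderiv IM (fun q ↦ mvfderiv IM (fun q ↦ coframe q (Z q)) q (Y q)) p (X p) +
      (lc (mvfderiv IM (fun q ↦ coframe q (Y q)) p (X p)) (coframe p (Z p)) +
        lc (coframe p (Y p)) (mvfderiv IM (fun q ↦ coframe q (Z q)) p (X p))) := by
  simp only [coframe_nabla]
  have h1 := ((hY.mvfderiv hZ.coframe) p).mdifferentiableAt (by simp : (∞ : WithTop ℕ∞) ≠ 0)
  have h2 : MDifferentiableAt IM 𝓘(ℝ, V)
      (fun q ↦ lc (coframe q (Y q)) (coframe q (Z q))) p :=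
    (((lc.contDiff.contMDiff.comp hY.coframe).clm_apply hZ.coframe) p).mdifferentiableAt
      (by simp : (∞ : WithTop ℕ∞) ≠ 0)
  rw [← mvfderiv_bilinear lc (hY.mdifferentiableAt_coframe p) (hZ.mdifferentiableAt_coframe p)]
  exact congrArg (fun T ↦ T (X p)) (mvfderiv_add h1 h2)

/-- In the frame, the second derivatives of the coefficients of `Z` cancel against the derivative
along `[X, Y]`. The first-order terms cancel too, those in `X` and `Y` through the Maurer-Cartan
equation, whose remaining term `br` completes `curv`. -/
theorem isCurvatureTensor_curvatureTensor : IsCurvatureTensor connection curvatureTensor := by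
  intro X Y Z hX hY hZ p
  apply injective_coframe p
  simp only [curvatureField, Pi.sub_apply, map_sub]
  rw [coframe_curvatureTensor, coframe_nabla, coframe_nabla, coframe_nabla,
    mvfderiv_coframe_nabla hY hZ, mvfderiv_coframe_nabla hX hZ, coframe_nabla, coframe_nabla,
    mvfderiv_mlieBracket_M hZ.coframe hX hY, coframe_mlieBracket hX hY, curv_apply]
  simp only [map_add, map_sub, add_apply, sub_apply]
  abel

theorem isStrictNearlyKahler_metric : IsStrictNearlyKahler metric connection := by
  -- Since `jj` is constant in the frame, the derivative terms of `∇J` cancel and only the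
  -- commutator of `lc` with `jj` remains.
  have key (X Y : ∀ p : M, TangentSpace IM p) (hY : IsSmoothField Y) (p : M) :
      coframe p (nabla connection X (fun q ↦ frame q (jj (coframe q (Y q)))) p -
        frame p (jj (coframe p (nabla connection X Y p)))) =
      lc (coframe p (X p)) (jj (coframe p (Y p))) -
        jj (lc (coframe p (X p)) (coframe p (Y p))) := by
    rw [map_sub, coframe_nabla, coframe_frame, coframe_nabla]
    simp only [coframe_frame]
    rw [mvfderiv_clm_comp jj (hY.mdifferentiableAt_coframe p), map_add]
    abel
  refine ⟨fun p ↦ ((frame p).comp (jj.comp (coframe p))).toLinearMap, fun X hX ↦ ?_,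
    fun p v ↦ ?_, fun p v w ↦ ?_, fun X hX p ↦ ?_, ?_⟩
  · exact isSmoothField_frame (jj.contDiff.contMDiff.comp hX.coframe)
  · apply injective_coframe p
    simp [jj_jj]
  · simp [metric_inner, ip_jj]
  · apply injective_coframe p
    rw [map_zero]
    refine (key X X hX p).trans ?_
    rw [lc_jj, sub_self]
  · obtain ⟨a, b, hab⟩ := exists_lc_jj_ne
    refine ⟨fun p ↦ frame p a, fun p ↦ frame p b, isSmoothField_frame_const a,
      isSmoothField_frame_const b, 1, fun h ↦ hab ?_⟩
    have h2 := key (fun p ↦ frame p a) (fun p ↦ frame p b) (isSmoothField_frame_const b) 1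
    rw [coframe_frame, coframe_frame] at h2
    exact sub_eq_zero.1 (h2.symm.trans ((congrArg (coframe 1) h).trans (map_zero _)))

theorem isEinstein_metric : IsEinstein metric curvatureTensor (5 / 12) := by
  intro p v w
  rw [metric_inner, ← trace_curv]
  exact LinearMap.trace_conj' ((curv.flip (coframe p v)).flip (coframe p w)) (coframeEquiv p).symm

/-! ### The Killing form, the isotropy complement, and the standard metric -/

/-- The vector space `ℝ³ × ℝ³ × ℝ³`, the Lie algebra of `SU(2)³`. -/
abbrev V3 : Type := R3 × R3 × R3

/-- The inclusion of `SU(2)³` into `ℍ × ℍ × ℍ`. -/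
def coeG : G →* ℍ[ℝ] × ℍ[ℝ] × ℍ[ℝ] := S3.coeHom.prodMap (S3.coeHom.prodMap S3.coeHom)

theorem contMDiff_coeG : ContMDiff IG 𝓘(ℝ, ℍ[ℝ] × ℍ[ℝ] × ℍ[ℝ]) ∞ coeG :=
  contMDiff_prodMap S3.contMDiff_coeHom contMDiff_coeM

theorem maurerCartan_coeG (v : 𝔤) :
    maurerCartan IG coeG 1 v = (maurerCartan (𝓡 3) S3.coeHom 1 v.1,
      maurerCartan (𝓡 3) S3.coeHom 1 v.2.1, maurerCartan (𝓡 3) S3.coeHom 1 v.2.2) :=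
  (maurerCartan_prodMap S3.contMDiff_coeHom contMDiff_coeM 1 v).trans
    (Prod.ext rfl (maurerCartan_coeM 1 v.2))

/-- The linear map from the Lie algebra of `SU(2)³` to `ℝ³ × ℝ³ × ℝ³`. -/
def coords : 𝔤 →L[ℝ] V3 :=
  (twiceIm.prodMap (twiceIm.prodMap twiceIm)).comp (maurerCartan IG coeG 1)

/-- The inclusion of the Lie algebra of `SU(2)³` into `ℍ × ℍ × ℍ`. -/
def inclG (a : V3) : ℍ[ℝ] × ℍ[ℝ] × ℍ[ℝ] :=
  (halfQuaternion a.1, halfQuaternion a.2.1, halfQuaternion a.2.2)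

theorem inclG_coords (v : 𝔤) : inclG (coords v) = maurerCartan IG coeG 1 v := by
  rw [maurerCartan_coeG]
  refine Prod.ext ?_ (Prod.ext ?_ ?_)
  · refine Eq.trans ?_ (halfQuaternion_twiceIm (S3.re_maurerCartan 1 v.1))
    exact congrArg (fun q : ℍ[ℝ] × ℍ[ℝ] × ℍ[ℝ] ↦ halfQuaternion (twiceIm q.1)) (maurerCartan_coeG v)
  · refine Eq.trans ?_ (halfQuaternion_twiceIm (S3.re_maurerCartan 1 v.2.1))
    exact congrArg (fun q : ℍ[ℝ] × ℍ[ℝ] × ℍ[ℝ] ↦ halfQuaternion (twiceIm q.2.1))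
      (maurerCartan_coeG v)
  · refine Eq.trans ?_ (halfQuaternion_twiceIm (S3.re_maurerCartan 1 v.2.2))
    exact congrArg (fun q : ℍ[ℝ] × ℍ[ℝ] × ℍ[ℝ] ↦ halfQuaternion (twiceIm q.2.2))
      (maurerCartan_coeG v)

theorem injective_coords : Function.Injective coords := by
  intro v w h
  have h' := congrArg inclG h
  rw [inclG_coords, inclG_coords, maurerCartan_coeG, maurerCartan_coeG, Prod.mk.injEq,
    Prod.mk.injEq] at h'
  exact Prod.ext (S3.injective_maurerCartan 1 h'.1)
    (Prod.ext (S3.injective_maurerCartan 1 h'.2.1) (S3.injective_maurerCartan 1 h'.2.2))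

instance : FiniteDimensional ℝ 𝔤 :=
  inferInstanceAs (FiniteDimensional ℝ
    (EuclideanSpace ℝ (Fin 3) × EuclideanSpace ℝ (Fin 3) × EuclideanSpace ℝ (Fin 3)))

/-- `coords` as an isomorphism. -/
def coordsEquiv : 𝔤 ≃ₗ[ℝ] V3 :=
  LinearEquiv.ofInjectiveOfFinrankEq coords.toLinearMap injective_coords (by
    change Module.finrank ℝ (EuclideanSpace ℝ (Fin 3) × EuclideanSpace ℝ (Fin 3) ×
      EuclideanSpace ℝ (Fin 3)) = _
    simp)

theorem coords_lie (v w : 𝔤) : coords ⁅v, w⁆ =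
    ((coords v).1 ⨯₃ (coords w).1, (coords v).2.1 ⨯₃ (coords w).2.1,
      (coords v).2.2 ⨯₃ (coords w).2.2) := by
  obtain ⟨a, ha⟩ := exists_ne (0 : V3)
  have hne : maurerCartan IG coeG 1 (coordsEquiv.symm a) ≠ 0 := by
    intro h
    apply ha
    rw [← coordsEquiv.apply_symm_apply a]
    exact (congrArg (twiceIm.prodMap (twiceIm.prodMap twiceIm)) h).trans (map_zero _)
  have h := maurerCartan_mlieBracket contMDiff_coeG (v := (coordsEquiv.symm a : 𝔤)) hne
    (isSmoothField_mulInvariantVectorField v) (isSmoothField_mulInvariantVectorField w) 1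
  simp only [maurerCartan_mulInvariantVectorField contMDiff_coeG, mvfderiv_const] at h
  rw [zero_apply, zero_apply, sub_zero, zero_add, ← GroupLieAlgebra.bracket_def,
    ← inclG_coords v, ← inclG_coords w] at h
  refine (congrArg (twiceIm.prodMap (twiceIm.prodMap twiceIm)) h).trans ?_
  refine Prod.ext ?_ (Prod.ext ?_ ?_) <;>
    exact (congrArg twiceIm (halfQuaternion_commutator _ _)).trans (twiceIm_halfQuaternion _)

/-- The Lie bracket of the Lie algebra of `SU(2)³` in coordinates. -/
def adV3 (a : V3) : V3 →ₗ[ℝ] V3 :=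
  (crossProduct a.1).prodMap ((crossProduct a.2.1).prodMap (crossProduct a.2.2))

theorem trace_adV3 (a b : V3) : LinearMap.trace ℝ V3 (adV3 a ∘ₗ adV3 b) =
    -2 * (a.1 ⬝ᵥ b.1 + a.2.1 ⬝ᵥ b.2.1 + a.2.2 ⬝ᵥ b.2.2) := by
  rw [LinearMap.trace_eq_matrix_trace ℝ ((Pi.basisFun ℝ (Fin 3)).prod
    ((Pi.basisFun ℝ (Fin 3)).prod (Pi.basisFun ℝ (Fin 3))))]
  simp [Matrix.trace, LinearMap.toMatrix_apply, Fin.sum_univ_three, adV3, cross_apply, dotProduct,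
    Pi.basisFun_apply]
  ring

theorem killingForm_apply_coords (v w : 𝔤) : killingForm ℝ 𝔤 v w =
    -2 * ((coords v).1 ⬝ᵥ (coords w).1 + (coords v).2.1 ⬝ᵥ (coords w).2.1 +
      (coords v).2.2 ⬝ᵥ (coords w).2.2) := by
  -- Trace is invariant under conjugation, so it can be computed with cross products in `ℝ³ × ℝ³ ×
  -- ℝ³`.
  have h : coordsEquiv.conj (LieAlgebra.ad ℝ 𝔤 v ∘ₗ LieAlgebra.ad ℝ 𝔤 w) =
      adV3 (coords v) ∘ₗ adV3 (coords w) := by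
    refine LinearMap.ext fun a ↦ ?_
    rw [LinearEquiv.conj_apply_apply]
    change coords ⁅v, ⁅w, coordsEquiv.symm a⁆⁆ = _
    have e : coords (coordsEquiv.symm a) = a := coordsEquiv.apply_symm_apply a
    rw [coords_lie, coords_lie, e]
    rfl
  rw [← trace_adV3, ← h, LinearMap.trace_conj', killingForm_apply_apply]

theorem contMDiff_proj : ContMDiff IG IM ∞ proj := by
  refine ContMDiff.prodMk ?_ ?_
  · exact (contMDiff_fst.mul contMDiff_const).mul (contMDiff_snd.comp contMDiff_snd).inv
  · exact ((contMDiff_fst.comp contMDiff_snd).mul contMDiff_const).mul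
      (contMDiff_snd.comp contMDiff_snd).inv

theorem contMDiff_act (k : G) : ContMDiff IM IM ∞ (act k) := by
  refine ContMDiff.prodMk ?_ ?_
  · exact (contMDiff_const.mul contMDiff_fst).mul contMDiff_const
  · exact (contMDiff_const.mul contMDiff_snd).mul contMDiff_const

theorem coframe_proj (X : 𝔤) :
    coframe (proj 1) (mfderiv IG IM proj 1 X) =
      ((coords X).1 - (coords X).2.2, (coords X).2.1 - (coords X).2.2) := by
  let L₁ : ℍ[ℝ] × ℍ[ℝ] × ℍ[ℝ] →L[ℝ] ℍ[ℝ] × ℍ[ℝ] :=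
    (ContinuousLinearMap.fst ℝ _ _).prod ((ContinuousLinearMap.fst ℝ _ _).comp
      (ContinuousLinearMap.snd ℝ _ _))
  let s : ℍ[ℝ] →ₗ[ℝ] ℍ[ℝ] :=
    { toFun := star, map_add' := star_add, map_smul' := fun c x ↦ by ext <;> simp }
  let S : ℍ[ℝ] × ℍ[ℝ] × ℍ[ℝ] →L[ℝ] ℍ[ℝ] := (LinearMap.toContinuousLinearMap s).comp
    ((ContinuousLinearMap.snd ℝ _ _).comp (ContinuousLinearMap.snd ℝ _ _))
  let L₂ : ℍ[ℝ] × ℍ[ℝ] × ℍ[ℝ] →L[ℝ] ℍ[ℝ] × ℍ[ℝ] := S.prod S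
  have hd := (contMDiff_coeG 1).mdifferentiableAt (by simp : (∞ : WithTop ℕ∞) ≠ 0)
  -- On unit quaternions inversion is conjugation, which is linear on `ℍ`; the orbit map becomes a
  -- product of two linear maps, to which the product rule applies.
  have e : (fun k ↦ coeM (proj k)) = fun k ↦ L₁ (coeG k) * L₂ (coeG k) := by
    funext k
    refine Prod.ext ?_ ?_
    · change S3.coeHom (k.1 * 1 * k.2.2⁻¹) = _
      rw [mul_one, map_mul, S3.coeHom_inv]
      rfl
    · change S3.coeHom (k.2.1 * 1 * k.2.2⁻¹) = _
      rw [mul_one, map_mul, S3.coeHom_inv]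
      rfl
  have h1 := mvfderiv_comp_mfderiv (1 : G)
    ((contMDiff_coeM (proj 1)).mdifferentiableAt (by simp : (∞ : WithTop ℕ∞) ≠ 0))
    ((contMDiff_proj 1).mdifferentiableAt (by simp : (∞ : WithTop ℕ∞) ≠ 0)) X
  have hL {L : ℍ[ℝ] × ℍ[ℝ] × ℍ[ℝ] →L[ℝ] ℍ[ℝ] × ℍ[ℝ]} :
      MDifferentiableAt IG 𝓘(ℝ, ℍ[ℝ] × ℍ[ℝ]) (fun k ↦ L (coeG k)) 1 :=
    L.differentiableAt.mdifferentiableAt.comp 1 hd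
  rw [e, mvfderiv_mul_algebra hL hL, mvfderiv_clm_comp L₁ hd,
    mvfderiv_clm_comp L₂ hd] at h1
  have hp : proj 1 = 1 := by simp [proj, act_one]
  have h2 : mvfderiv IG coeG 1 X = inclG (coords X) := by
    rw [inclG_coords, mvfderiv_eq_mul_maurerCartan, map_one, one_mul]
  have h3 : maurerCartan IM coeM (proj 1) (mfderiv IG IM proj 1 X) =
      L₂ (inclG (coords X)) + L₁ (inclG (coords X)) := by
    have a1 : L₁ (coeG 1) = 1 := rfl
    have a2 : L₂ (coeG 1) = 1 := by
      refine Prod.ext ?_ ?_ <;> exact star_one _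
    rw [h2, a1, a2, one_mul, mul_one] at h1
    rw [h1, mvfderiv_eq_mul_maurerCartan, hp, map_one, one_mul]
  refine (congrArg (twiceIm.prodMap twiceIm) h3).trans ?_
  have k (u v : R3) : twiceIm (star (halfQuaternion v) + halfQuaternion u) = u - v := by
    ext i; fin_cases i <;> simp [twiceIm_apply] <;> ring
  exact Prod.ext (k _ _) (k _ _)

theorem mem_𝔥_iff (X : 𝔤) :
    X ∈ 𝔥 ↔ (coords X).1 = (coords X).2.2 ∧ (coords X).2.1 = (coords X).2.2 := by
  have h : X ∈ 𝔥 ↔ mfderiv IG IM proj 1 X = 0 := Iff.rfl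
  rw [h, ← (injective_coframe _).eq_iff, map_zero, coframe_proj, Prod.mk_eq_zero,
    sub_eq_zero, sub_eq_zero]

theorem mem_𝔭_iff (X : 𝔤) :
    X ∈ 𝔭 ↔ (coords X).1 + (coords X).2.1 + (coords X).2.2 = 0 := by
  rw [𝔭, LinearMap.BilinForm.mem_orthogonal_iff]
  constructor
  · intro h
    set s := (coords X).1 + (coords X).2.1 + (coords X).2.2 with hs
    -- Orthogonality to the diagonal element built from the sum `s` itself gives `s · s = 0`.
    have e : coords (coordsEquiv.symm (s, s, s)) = (s, s, s) := coordsEquiv.apply_symm_apply _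
    have h1 := h (coordsEquiv.symm (s, s, s)) ((mem_𝔥_iff _).2 (by rw [e]; exact ⟨rfl, rfl⟩))
    rw [killingForm_apply_coords, e, ← dotProduct_add,
      ← dotProduct_add, ← hs] at h1
    exact dotProduct_self_eq_zero.1 (by simpa using h1)
  · intro h Y hY
    obtain ⟨h1, h2⟩ := (mem_𝔥_iff Y).1 hY
    rw [killingForm_apply_coords, h1, h2, ← dotProduct_add,
      ← dotProduct_add, h, dotProduct_zero, mul_zero]

/-- The dot product is `-4 Re(uv)` on half quaternions, hence invariant under conjugation. As `ip`
contains dot products across the two factors, both must be conjugated by the same `c`. -/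
theorem ip_coframe_conj {a b a' b' : V} (c : S3)
    (ha : incl a' = coeM (c, c) * incl a * coeM (c, c)⁻¹)
    (hb : incl b' = coeM (c, c) * incl b * coeM (c, c)⁻¹) : ip a' b' = ip a b := by
  have key (u v : R3) : u ⬝ᵥ v = -4 * (halfQuaternion u * halfQuaternion v).re := by
    simp [dotProduct, Fin.sum_univ_three]; ring
  have hc : S3.coeHom c⁻¹ * S3.coeHom c = 1 := by rw [← map_mul, inv_mul_cancel, map_one]
  have hre (x y : ℍ[ℝ]) : (x * y).re = (y * x).re := by simp; ring
  have conj {u v u' v' : R3}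
      (hu : halfQuaternion u' = S3.coeHom c * halfQuaternion u * S3.coeHom c⁻¹)
      (hv : halfQuaternion v' = S3.coeHom c * halfQuaternion v * S3.coeHom c⁻¹) :
      u' ⬝ᵥ v' = u ⬝ᵥ v := by
    have : S3.coeHom c * halfQuaternion u * S3.coeHom c⁻¹ *
        (S3.coeHom c * halfQuaternion v * S3.coeHom c⁻¹) =
        S3.coeHom c * (halfQuaternion u * halfQuaternion v * S3.coeHom c⁻¹) := by
      calc _ = S3.coeHom c * halfQuaternion u * (S3.coeHom c⁻¹ * S3.coeHom c) *
            halfQuaternion v * S3.coeHom c⁻¹ := by simp only [mul_assoc]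
        _ = _ := by rw [hc, mul_one]; simp only [mul_assoc]
    rw [key, key, hu, hv, this, hre, mul_assoc, hc, mul_one]
  have ha1 := congrArg Prod.fst ha
  have ha2 := congrArg Prod.snd ha
  have hb1 := congrArg Prod.fst hb
  have hb2 := congrArg Prod.snd hb
  rw [ip_apply, ip_apply, conj ha1 hb1, conj ha2 hb2, conj ha1 hb2, conj ha2 hb1]

theorem incl_coframe_act (k : G) (p : M) (v : TangentSpace IM p) :
    incl (coframe (act k p) (mfderiv IM IM (act k) p v)) =
      coeM (k.2.2, k.2.2) * incl (coframe p v) * coeM (k.2.2, k.2.2)⁻¹ := by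
  have e (q : M) : coeM (act k q) = coeM (k.1, k.2.1) * coeM q * coeM (k.2.2, k.2.2)⁻¹ := by
    rw [← map_mul, ← map_mul]; rfl
  let L : ℍ[ℝ] × ℍ[ℝ] →L[ℝ] ℍ[ℝ] × ℍ[ℝ] :=
    ((ContinuousLinearMap.mul ℝ _).flip (coeM (k.2.2, k.2.2)⁻¹)).comp
      (ContinuousLinearMap.mul ℝ _ (coeM (k.1, k.2.1)))
  have hd := (contMDiff_coeM p).mdifferentiableAt (by simp : (∞ : WithTop ℕ∞) ≠ 0)
  have h1 := mvfderiv_comp_mfderiv p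
    ((contMDiff_coeM (act k p)).mdifferentiableAt (by simp : (∞ : WithTop ℕ∞) ≠ 0))
    ((contMDiff_act k p).mdifferentiableAt (by simp : (∞ : WithTop ℕ∞) ≠ 0)) v
  simp only [e] at h1
  have h2 := (mvfderiv_clm_comp L hd v).symm.trans h1
  rw [mvfderiv_eq_mul_maurerCartan, mvfderiv_eq_mul_maurerCartan] at h2
  rw [incl_coframe, incl_coframe]
  have h3 := congrArg (fun q ↦ coeM (act k p)⁻¹ * q) h2
  simp only [← mul_assoc, ← map_mul, inv_mul_cancel, map_one, one_mul] at h3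
  rw [← h3]
  change coeM (act k p)⁻¹ * (coeM (k.1, k.2.1) * (coeM p * _) * coeM (k.2.2, k.2.2)⁻¹) = _
  simp only [← mul_assoc, ← map_mul]
  congr 3
  refine Prod.ext ?_ ?_ <;> simp [act, mul_assoc]

theorem isStandardMetric_metric : IsStandardMetric metric where
  invariant k p u v := ip_coframe_conj k.2.2 (incl_coframe_act k p u) (incl_coframe_act k p v)
  base X hX Y hY := by
    rw [mem_𝔭_iff] at hX hY
    rw [metric_inner, coframe_proj, coframe_proj, killingForm_apply_coords, ip_apply,
      eq_neg_of_add_eq_zero_right hX, eq_neg_of_add_eq_zero_right hY]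
    simp only [sub_neg_eq_add, dotProduct_add, add_dotProduct, neg_dotProduct, dotProduct_neg]
    ring

theorem exists_mem_𝔭_proj (w : TangentSpace IM (proj 1)) :
    ∃ X ∈ 𝔭, mfderiv IG IM proj 1 X = w := by
  set a := coframe (proj 1) w with ha
  -- The solution of `u - w = a.1`, `v - w = a.2`, `u + v + w = 0`.
  let b : V3 := ((2 / 3 : ℝ) • a.1 - (1 / 3 : ℝ) • a.2, (2 / 3 : ℝ) • a.2 - (1 / 3 : ℝ) • a.1,
    -(1 / 3 : ℝ) • (a.1 + a.2))
  have e : coords (coordsEquiv.symm b) = b := coordsEquiv.apply_symm_apply _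
  refine ⟨coordsEquiv.symm b, ?_, ?_⟩
  · rw [mem_𝔭_iff, e]
    simp only [b]
    module
  · apply injective_coframe
    rw [coframe_proj, e, ← ha]
    refine Prod.ext ?_ ?_
    · simp only [b]; module
    · simp only [b]; module

theorem IsStandardMetric.eq_metric {g : SmoothMetric IM M} (hg : IsStandardMetric g) :
    g = metric := by
  have h0 (u v : TangentSpace IM (proj 1)) : g.inner (proj 1) u v = metric.inner (proj 1) u v := by
    obtain ⟨X, hX, rfl⟩ := exists_mem_𝔭_proj u
    obtain ⟨Y, hY, rfl⟩ := exists_mem_𝔭_proj v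
    rw [hg.base X hX Y hY, isStandardMetric_metric.base X hX Y hY]
  have h1 (p : M) (u v : TangentSpace IM p) : g.inner p u v = metric.inner p u v := by
    obtain ⟨k, rfl⟩ : ∃ k, p = act k (proj 1) := by
      obtain ⟨k, rfl⟩ := proj_surjective p
      exact ⟨k, by rw [proj, proj, act_one]⟩
    -- A linear map preserving a positive definite form is injective, and by equality of dimensions
    -- surjective.
    have hinj : Function.Injective (mfderiv IM IM (act k) (proj 1)) := by
      rw [injective_iff_map_eq_zero]
      intro w hw
      by_contra hne
      have h2 := metric.pos _ w hne
      rw [← isStandardMetric_metric.invariant k (proj 1) w w, hw, map_zero] at h2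
      exact lt_irrefl _ h2
    have hsurj : Function.Surjective (mfderiv IM IM (act k) (proj 1)) :=
      (LinearMap.injective_iff_surjective_of_finrank_eq_finrank (K := ℝ)
        (f := (mfderiv IM IM (act k) (proj 1)).toLinearMap) rfl).1 hinj
    obtain ⟨u, rfl⟩ := hsurj u
    obtain ⟨v, rfl⟩ := hsurj v
    rw [hg.invariant, isStandardMetric_metric.invariant, h0]
  have h2 : g.inner = metric.inner := by
    funext p
    ext u v
    exact h1 p u v
  cases g
  subst h2
  rfl

/-! ### Isometries preserve the covariant derivative of curvature -/

/-- The vector fields `X` and `X'` are `s`-related. -/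
def Related (s : M → M) (X X' : ∀ p : M, TangentSpace IM p) : Prop :=
  ∀ p, mfderiv IM IM s p (X p) = X' (s p)

section Related
variable {s : M → M} {X Y Z W X' Y' Z' W' : ∀ p : M, TangentSpace IM p}

theorem Related.mvfderiv_comp {F : Type*} [NormedAddCommGroup F] [NormedSpace ℝ F] {f : M → F}
    (h : Related s X X') (hs : ContMDiff IM IM ∞ s) (hf : ContMDiff IM 𝓘(ℝ, F) ∞ f) (p : M) :
    mvfderiv IM (fun q ↦ f (s q)) p (X p) = mvfderiv IM f (s p) (X' (s p)) := by
  rw [← h p]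
  exact mvfderiv_comp_mfderiv p ((hf (s p)).mdifferentiableAt (by simp))
    ((hs p).mdifferentiableAt (by simp)) (X p)

theorem injective_mvfderiv_coeM (p : M) : Function.Injective (mvfderiv IM coeM p) := by
  intro v w h
  apply injective_coframe p
  exact congrArg (fun q ↦ twiceIm.prodMap twiceIm (coeM p⁻¹ * q)) h

/-- The embedding `coeM` has injective differential, so the two sides may be compared as derivations
of `coeM`, where relatedness is the chain rule. -/
theorem Related.mlieBracket (hX : Related s X X') (hY : Related s Y Y')
    (hs : ContMDiff IM IM ∞ s) (sX : IsSmoothField X) (sY : IsSmoothField Y)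
    (sX' : IsSmoothField X') (sY' : IsSmoothField Y') :
    Related s (mlieBracket IM X Y) (mlieBracket IM X' Y') := by
  intro p
  apply injective_mvfderiv_coeM
  refine (mvfderiv_comp_mfderiv p ((contMDiff_coeM (s p)).mdifferentiableAt (by simp))
    ((hs p).mdifferentiableAt (by simp)) _).symm.trans ?_
  have hc : ContMDiff IM 𝓘(ℝ, ℍ[ℝ] × ℍ[ℝ]) ∞ fun q ↦ coeM (s q) := contMDiff_coeM.comp hs
  rw [mvfderiv_mlieBracket_M contMDiff_coeM sX' sY', mvfderiv_mlieBracket_M hc sX sY]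
  have e1 : (fun q ↦ mvfderiv IM (fun q ↦ coeM (s q)) q (X q)) =
      fun q ↦ mvfderiv IM coeM (s q) (X' (s q)) := funext (hX.mvfderiv_comp hs contMDiff_coeM)
  have e2 : (fun q ↦ mvfderiv IM (fun q ↦ coeM (s q)) q (Y q)) =
      fun q ↦ mvfderiv IM coeM (s q) (Y' (s q)) := funext (hY.mvfderiv_comp hs contMDiff_coeM)
  rw [← hX.mvfderiv_comp hs (sY'.mvfderiv contMDiff_coeM),
    ← hY.mvfderiv_comp hs (sX'.mvfderiv contMDiff_coeM)]
  exact congrArg₂ (fun f g ↦ mvfderiv IM f p (X p) - mvfderiv IM g p (Y p)) e2 e1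

/-- This expresses the connection through inner products and brackets alone, both of which
isometries respect. -/
theorem koszul (sX : IsSmoothField X) (sY : IsSmoothField Y) (sZ : IsSmoothField Z) (p : M) :
    2 * metric.inner p (nabla connection X Y p) (Z p) =
      mvfderiv IM (fun q ↦ metric.inner q (Y q) (Z q)) p (X p) +
      mvfderiv IM (fun q ↦ metric.inner q (X q) (Z q)) p (Y p) -
      mvfderiv IM (fun q ↦ metric.inner q (X q) (Y q)) p (Z p) +
      metric.inner p (mlieBracket IM X Y p) (Z p) -
      metric.inner p (mlieBracket IM X Z p) (Y p) -
      metric.inner p (mlieBracket IM Y Z p) (X p) := by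
  have h := isLeviCivita_connection.2
  rw [h X Y Z sX sY sZ, h Y X Z sY sX sZ, h Z X Y sZ sX sY, ← nabla_sub_nabla sX sY,
    ← nabla_sub_nabla sX sZ, ← nabla_sub_nabla sY sZ, metric.symm p (Y p), metric.symm p (X p),
    metric.symm p (X p)]
  simp only [map_sub, sub_apply]
  ring

/-- `s` is an isometry of `metric`. -/
def IsMetricPreserving (s : M → M) : Prop :=
  ∀ (p : M) (u v : TangentSpace IM p),
    metric.inner (s p) (mfderiv IM IM s p u) (mfderiv IM IM s p v) = metric.inner p u v

theorem contMDiff_metric_inner (sX : IsSmoothField X) (sY : IsSmoothField Y) :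
    ContMDiff IM 𝓘(ℝ, ℝ) ∞ fun p ↦ metric.inner p (X p) (Y p) :=
  (ip.contDiff.contMDiff.comp sX.coframe).clm_apply sY.coframe

theorem Related.mvfderiv_inner (hX : Related s X X') (hY : Related s Y Y') (hZ : Related s Z Z')
    (hs : ContMDiff IM IM ∞ s) (hm : IsMetricPreserving s)
    (sY' : IsSmoothField Y') (sZ' : IsSmoothField Z') (p : M) :
    mvfderiv IM (fun q ↦ metric.inner q (Y q) (Z q)) p (X p) =
      mvfderiv IM (fun q ↦ metric.inner q (Y' q) (Z' q)) (s p) (X' (s p)) := by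
  rw [← hX.mvfderiv_comp hs (contMDiff_metric_inner sY' sZ')]
  have e : (fun q ↦ metric.inner q (Y q) (Z q)) =
      fun q ↦ metric.inner (s q) (Y' (s q)) (Z' (s q)) :=
    funext fun q ↦ by rw [← hY q, ← hZ q, hm]
  rw [e]

theorem Related.nabla_inner (hX : Related s X X') (hY : Related s Y Y') (hZ : Related s Z Z')
    (hs : ContMDiff IM IM ∞ s) (hm : IsMetricPreserving s)
    (sX : IsSmoothField X) (sY : IsSmoothField Y) (sZ : IsSmoothField Z)
    (sX' : IsSmoothField X') (sY' : IsSmoothField Y') (sZ' : IsSmoothField Z') (p : M) :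
    metric.inner (s p) (mfderiv IM IM s p (nabla connection X Y p)) (Z' (s p)) =
      metric.inner (s p) (nabla connection X' Y' (s p)) (Z' (s p)) := by
  have h1 := koszul sX sY sZ p
  have h2 := koszul sX' sY' sZ' (s p)
  rw [hX.mvfderiv_inner hY hZ hs hm sY' sZ', hY.mvfderiv_inner hX hZ hs hm sX' sZ',
    hZ.mvfderiv_inner hX hY hs hm sX' sY', ← hm p (VectorField.mlieBracket IM X Y p),
    ← hm p (VectorField.mlieBracket IM X Z p), ← hm p (VectorField.mlieBracket IM Y Z p),
    ← hm p (nabla connection X Y p),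
    hX.mlieBracket hY hs sX sY sX' sY' p, hX.mlieBracket hZ hs sX sZ sX' sZ' p,
    hY.mlieBracket hZ hs sY sZ sY' sZ' p, hX p, hY p, hZ p] at h1
  linarith

end Related

theorem exists_related (s : M ≃ₘ⟮IM, IM⟯ M) {X' : ∀ p : M, TangentSpace IM p}
    (sX' : IsSmoothField X') : ∃ X, IsSmoothField X ∧ Related s X X' := by
  have hi (p : M) : (mfderiv IM IM s p).IsInvertible :=
    ⟨s.mfderivToContinuousLinearEquiv (by simp) p, rfl⟩
  have : IsManifold IM (((⊤ : ℕ∞) : WithTop ℕ∞) + 1) M := inferInstanceAs (IsManifold IM ∞ M)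
  exact ⟨mpullback IM IM s X', ContMDiff.mpullback_vectorField (m := ((⊤ : ℕ∞) : WithTop ℕ∞))
    (n := ∞) sX' s.contMDiff hi le_rfl, fun p ↦ (hi p).self_apply_inverse _⟩

section Isometry
variable {s : M ≃ₘ⟮IM, IM⟯ M} {X Y Z W X' Y' Z' W' : ∀ p : M, TangentSpace IM p}

theorem Related.nabla (hX : Related s X X') (hY : Related s Y Y') (hm : IsMetricPreserving s)
    (sX : IsSmoothField X) (sY : IsSmoothField Y)
    (sX' : IsSmoothField X') (sY' : IsSmoothField Y') :
    Related s (nabla connection X Y) (nabla connection X' Y') := by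
  intro p
  apply injective_coframe
  -- It suffices to pair with every frame field at `s p`; each is related to its pullback under the
  -- diffeomorphism.
  refine ip_ext fun c ↦ ?_
  obtain ⟨Z, sZ, hZ⟩ := exists_related s (isSmoothField_frame_const c)
  have h := hX.nabla_inner hY hZ s.contMDiff hm sX sY sZ sX' sY' (isSmoothField_frame_const c) p
  simpa only [metric_inner, coframe_frame] using h

/-- The vector field `R(X,Y)Z`. -/
def curvatureApply (X Y Z : ∀ p : M, TangentSpace IM p) : ∀ p : M, TangentSpace IM p :=
  fun p ↦ curvatureTensor p (X p) (Y p) (Z p)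

theorem curvatureApply_eq (sX : IsSmoothField X) (sY : IsSmoothField Y) (sZ : IsSmoothField Z) :
    curvatureApply X Y Z = curvatureField connection X Y Z :=
  funext (isCurvatureTensor_curvatureTensor X Y Z sX sY sZ)

theorem Related.sub {s : M → M} (hX : Related s X X') (hY : Related s Y Y') :
    Related s (X - Y) (X' - Y') :=
  fun p ↦ (map_sub _ _ _).trans (congrArg₂ _ (hX p) (hY p))

theorem Related.curvatureApply (hX : Related s X X') (hY : Related s Y Y') (hZ : Related s Z Z')
    (hm : IsMetricPreserving s)
    (sX : IsSmoothField X) (sY : IsSmoothField Y) (sZ : IsSmoothField Z)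
    (sX' : IsSmoothField X') (sY' : IsSmoothField Y') (sZ' : IsSmoothField Z') :
    Related s (curvatureApply X Y Z) (curvatureApply X' Y' Z') := by
  rw [curvatureApply_eq sX sY sZ, curvatureApply_eq sX' sY' sZ']
  exact ((hX.nabla (hY.nabla hZ hm sY sZ sY' sZ') hm sX (sY.nabla sZ) sX' (sY'.nabla sZ')).sub
    (hY.nabla (hX.nabla hZ hm sX sZ sX' sZ') hm sY (sX.nabla sZ) sY' (sX'.nabla sZ'))).sub
    ((hX.mlieBracket hY s.contMDiff sX sY sX' sY').nabla hZ hm (sX.mlieBracket sY) sZ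
      (sX'.mlieBracket sY') sZ')

/-- The curvature tensor on left-invariant vector fields as a continuous multilinear map. -/
def curvCLM : V →L[ℝ] V →L[ℝ] V →L[ℝ] V :=
  mkCLM₂ (curv.compr₂ LinearMap.toContinuousLinearMap.toLinearMap)

theorem coframe_curvatureApply (p : M) : coframe p (curvatureApply X Y Z p) =
    curvCLM (coframe p (X p)) (coframe p (Y p)) (coframe p (Z p)) :=
  coframe_curvatureTensor p _ _ _

set_option synthInstance.maxHeartbeats 200000 in
theorem contMDiff_curvCLM (sX : IsSmoothField X) (sY : IsSmoothField Y) :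
    ContMDiff IM 𝓘(ℝ, V →L[ℝ] V) ∞ fun p ↦ curvCLM (coframe p (X p)) (coframe p (Y p)) :=
  (curvCLM.contDiff.contMDiff.comp sX.coframe).clm_apply sY.coframe

theorem IsSmoothField.curvatureApply (sX : IsSmoothField X) (sY : IsSmoothField Y)
    (sZ : IsSmoothField Z) : IsSmoothField (curvatureApply X Y Z) := by
  rw [isSmoothField_iff]
  simp only [coframe_curvatureApply]
  exact (contMDiff_curvCLM sX sY).clm_apply sZ.coframe

/-- The vector field `(∇_W R)(X,Y)Z`. -/
def nablaCurvature (W X Y Z : ∀ p : M, TangentSpace IM p) : ∀ p : M, TangentSpace IM p :=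
  NearlyKahlerS3S3.nabla connection W (curvatureApply X Y Z) -
    curvatureApply (NearlyKahlerS3S3.nabla connection W X) Y Z -
    curvatureApply X (NearlyKahlerS3S3.nabla connection W Y) Z -
    curvatureApply X Y (NearlyKahlerS3S3.nabla connection W Z)

theorem Related.nablaCurvature (hW : Related s W W') (hX : Related s X X') (hY : Related s Y Y')
    (hZ : Related s Z Z') (hm : IsMetricPreserving s)
    (sW : IsSmoothField W) (sX : IsSmoothField X) (sY : IsSmoothField Y) (sZ : IsSmoothField Z)
    (sW' : IsSmoothField W') (sX' : IsSmoothField X') (sY' : IsSmoothField Y')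
    (sZ' : IsSmoothField Z') :
    Related s (nablaCurvature W X Y Z) (nablaCurvature W' X' Y' Z') :=
  (((hW.nabla (hX.curvatureApply hY hZ hm sX sY sZ sX' sY' sZ') hm sW (sX.curvatureApply sY sZ)
    sW' (sX'.curvatureApply sY' sZ')).sub
    ((hW.nabla hX hm sW sX sW' sX').curvatureApply hY hZ hm (sW.nabla sX) sY sZ (sW'.nabla sX')
      sY' sZ')).sub
    (hX.curvatureApply (hW.nabla hY hm sW sY sW' sY') hZ hm sX (sW.nabla sY) sZ sX'
      (sW'.nabla sY') sZ')).sub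
    (hX.curvatureApply hY (hW.nabla hZ hm sW sZ sW' sZ') hm sX sY (sW.nabla sZ) sX' sY'
      (sW'.nabla sZ'))

-- The coefficients of `R` are constant in the frame, so the derivative terms in `∇R` cancel and
-- only the algebraic expression `dcurv` is left.
set_option synthInstance.maxHeartbeats 200000 in
theorem coframe_nablaCurvature (sX : IsSmoothField X) (sY : IsSmoothField Y)
    (sZ : IsSmoothField Z) (p : M) :
    coframe p (nablaCurvature W X Y Z p) =
      dcurv (coframe p (W p)) (coframe p (X p)) (coframe p (Y p)) (coframe p (Z p)) := by
  have h : mvfderiv IM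
      (fun q ↦ curvCLM (coframe q (X q)) (coframe q (Y q)) (coframe q (Z q))) p (W p) = _ :=
    mvfderiv_bilinear (ContinuousLinearMap.id ℝ (V →L[ℝ] V))
      (((contMDiff_curvCLM sX sY) p).mdifferentiableAt (by simp : (∞ : WithTop ℕ∞) ≠ 0))
      (sZ.mdifferentiableAt_coframe p) (W p)
  rw [mvfderiv_bilinear curvCLM (sX.mdifferentiableAt_coframe p)
    (sY.mdifferentiableAt_coframe p)] at h
  simp only [nablaCurvature, Pi.sub_apply, map_sub, coframe_curvatureApply, coframe_nabla]
  rw [h]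
  have e (a b c : V) : curvCLM a b c = curv a b c := rfl
  simp only [ContinuousLinearMap.id_apply, map_add, add_apply, dcurv, e]
  abel

end Isometry

theorem dcurv_neg (w a b c : V) : dcurv (-w) (-a) (-b) (-c) = dcurv w a b c := by
  simp [dcurv]

/-- With differential `-id` at the fixed point, the four arguments of `∇R` contribute sign `+1` and
its value sign `-1`, so `∇R` would vanish there. -/
theorem not_isSymmetricSpace_metric : ¬ IsSymmetricSpace metric := by
  intro h
  obtain ⟨w, a, b, c, hne⟩ := exists_dcurv_ne
  obtain ⟨s, hm, hx, hd⟩ := h 1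
  have sF (a : V) := isSmoothField_frame_const a
  obtain ⟨W, sW, hW⟩ := exists_related s (sF w)
  obtain ⟨A, sA, hA⟩ := exists_related s (sF a)
  obtain ⟨B, sB, hB⟩ := exists_related s (sF b)
  obtain ⟨C, sC, hC⟩ := exists_related s (sF c)
  have key (v : TangentSpace IM (1 : M)) :
      coframe (s 1) (mfderiv IM IM s 1 v) = -coframe 1 v := by
    -- The tangent spaces at `s 1` and `1` agree only along the equation `s 1 = 1`; generalizing the
    -- point permits the substitution.
    have aux (q : M) (hq : q = 1) (u : TangentSpace IM q)
        (hu : (u : EuclideanSpace ℝ (Fin 3) × EuclideanSpace ℝ (Fin 3)) =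
          -(v : EuclideanSpace ℝ (Fin 3) × EuclideanSpace ℝ (Fin 3))) :
        coframe q u = -coframe 1 v := by
      subst hq
      exact (congrArg (coframe _) hu).trans (map_neg (coframe _) v)
    exact aux (s 1) hx _ (hd v)
  have hval {X : ∀ p : M, TangentSpace IM p} {v : V} (hX : Related s X fun p ↦ frame p v) :
      coframe 1 (X 1) = -v := by
    rw [← neg_eq_iff_eq_neg, ← key, hX 1, coframe_frame]
  have h1 := hW.nablaCurvature hA hB hC hm sW sA sB sC (sF w) (sF a) (sF b) (sF c) 1
  have h2 := congrArg (coframe (s 1)) h1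
  rw [key, coframe_nablaCurvature sA sB sC, coframe_nablaCurvature (sF a) (sF b) (sF c), hval hW,
    hval hA, hval hB, hval hC, dcurv_neg] at h2
  simp only [coframe_frame] at h2
  exact hne (self_eq_neg.1 h2.symm)

/-! ### Linear algebra of diagonalizable endomorphisms -/

section Diagonal
variable {W : Type*} [AddCommGroup W] [Module ℝ W] {ι : Type*} [Fintype ι] [DecidableEq ι]

theorem finrank_eigenspace_of_basis (b : Module.Basis ι ℝ W) {f : Module.End ℝ W} {c : ι → ℝ}
    (hf : ∀ i, f (b i) = c i • b i) (μ : ℝ) :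
    Module.finrank ℝ (f.eigenspace μ) = (Finset.univ.filter fun i ↦ c i = μ).card := by
  have := b.finiteDimensional_of_finite
  -- The rank of a diagonal matrix counts its nonzero entries; rank-nullity then counts the indices
  -- with `c i = μ`.
  have h1 : LinearMap.toMatrix b b (f - μ • LinearMap.id) = Matrix.diagonal fun i ↦ c i - μ := by
    ext i j
    rw [LinearMap.toMatrix_apply]
    by_cases h : i = j
    · subst h; simp [hf]
    · simp [hf, h]
  have h2 := Matrix.rank_diagonal fun i ↦ c i - μ
  rw [← h1, Matrix.rank_eq_finrank_range_toLin _ b b, Matrix.toLin_toMatrix] at h2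
  have h3 := LinearMap.finrank_range_add_finrank_ker (f - μ • LinearMap.id)
  rw [h2, Module.finrank_eq_card_basis b, Fintype.card_subtype] at h3
  have h4 := Finset.card_filter_add_card_filter_not (s := Finset.univ) fun i ↦ c i = μ
  simp only [sub_ne_zero] at h3
  rw [Finset.card_univ] at h4
  have h5 : f.eigenspace μ = LinearMap.ker (f - μ • LinearMap.id) := by
    rw [Module.End.eigenspace_def]; rfl
  rw [h5]
  simp only [ne_eq] at h3
  omega

theorem hasEigenvalue_iff_of_basis (b : Module.Basis ι ℝ W) {f : Module.End ℝ W} {c : ι → ℝ}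
    (hf : ∀ i, f (b i) = c i • b i) (μ : ℝ) : f.HasEigenvalue μ ↔ ∃ i, c i = μ := by
  have := b.finiteDimensional_of_finite
  rw [Module.End.hasEigenvalue_iff, Ne, ← Submodule.finrank_eq_zero (R := ℝ),
    finrank_eigenspace_of_basis b hf, Finset.card_eq_zero, Finset.filter_eq_empty_iff]
  simp

/-- A family whose cardinality is the dimension and which decomposes every vector is a basis. -/
def basisOfDecomposition {w : ι → W} {φ : ι → Module.Dual ℝ W}
    (h : ∀ u, ∑ i, φ i u • w i = u) (hc : Fintype.card ι = Module.finrank ℝ W) :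
    Module.Basis ι ℝ W :=
  basisOfTopLeSpanOfCardEqFinrank w (fun u _ ↦ by
    rw [← h u]
    exact Submodule.sum_mem _ fun i _ ↦ Submodule.smul_mem _ _ (Submodule.subset_span ⟨i, rfl⟩)) hc

/-- A spanning family of the right cardinality is a basis, so uniqueness of coordinates forces `φ i
(w j) = δᵢⱼ`. No pairwise orthogonality has to be checked. -/
theorem sum_smul_of_decomposition {w : ι → W} {φ : ι → Module.Dual ℝ W}
    (h : ∀ u, ∑ i, φ i u • w i = u) (hc : Fintype.card ι = Module.finrank ℝ W) (c : ι → ℝ) (j : ι) :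
    ∑ i, (c i * φ i (w j)) • w i = c j • w j := by
  have hb (i : ι) : basisOfDecomposition h hc i = w i := by simp [basisOfDecomposition]
  have h1 (i : ι) : φ i (w j) = if i = j then 1 else 0 := by
    have h2 := congrArg (fun u ↦ (basisOfDecomposition h hc).repr u i) (h (w j))
    simpa [← hb, map_sum, Finsupp.single_apply, eq_comm] using h2
  simp [h1]

end Diagonal

/-! ### Bivectors and the spectral decomposition of the curvature operator -/

section Wedge
variable {x : M}

theorem wedge_add_left (X X' Y : TangentSpace IM x) :
    wedge (X + X') Y = wedge X Y + wedge X' Y :=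
  (exteriorPower.ιMulti ℝ 2).map_vecCons_add ![Y] X X'

theorem wedge_smul_left (c : ℝ) (X Y : TangentSpace IM x) :
    wedge (c • X) Y = c • wedge X Y :=
  (exteriorPower.ιMulti ℝ 2).map_vecCons_smul ![Y] c X

theorem wedge_swap (X Y : TangentSpace IM x) : wedge X Y = -wedge Y X := by
  have := (exteriorPower.ιMulti ℝ 2 (M := TangentSpace IM x)).map_swap ![Y, X]
    (i := 0) (j := 1) (by decide)
  rw [wedge, wedge, ← this]
  congr 1
  ext i; fin_cases i <;> simp

theorem wedge_self (X : TangentSpace IM x) : wedge X X = 0 :=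
  (exteriorPower.ιMulti ℝ 2 (M := TangentSpace IM x)).map_eq_zero_of_eq ![X, X]
    (i := 0) (j := 1) rfl (by decide)

theorem wedge_add_right (X Y Y' : TangentSpace IM x) :
    wedge X (Y + Y') = wedge X Y + wedge X Y' := by
  rw [wedge_swap, wedge_add_left, wedge_swap X Y, wedge_swap X Y']; abel

theorem wedge_smul_right (c : ℝ) (X Y : TangentSpace IM x) :
    wedge X (c • Y) = c • wedge X Y := by
  rw [wedge_swap, wedge_smul_left, wedge_swap X Y, smul_neg]

theorem bivector_induction {F : Type*} [AddCommGroup F] [Module ℝ F] {f g : Bivector IM x →ₗ[ℝ] F}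
    (h : ∀ X Y, f (wedge X Y) = g (wedge X Y)) : f = g := by
  refine exteriorPower.linearMap_ext ?_
  ext v
  have e : v = ![v 0, v 1] := by ext i; fin_cases i <;> rfl
  rw [e]
  exact h _ _

end Wedge

/-- The left-invariant fields `(eᵢ, eᵢ)`. -/
def sumField (x : M) (i : Fin 3) : TangentSpace IM x := frame x (Pi.single i 1, Pi.single i 1)

/-- The left-invariant fields `(eᵢ, -eᵢ)`. -/
def diffField (x : M) (i : Fin 3) : TangentSpace IM x := frame x (Pi.single i 1, -Pi.single i 1)

/-- The components with respect to `sumField`. -/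
def sumCoord {x : M} (v : TangentSpace IM x) (i : Fin 3) : ℝ :=
  ((coframe x v).1 i + (coframe x v).2 i) / 2

/-- The components with respect to `diffField`. -/
def diffCoord {x : M} (v : TangentSpace IM x) (i : Fin 3) : ℝ :=
  ((coframe x v).1 i - (coframe x v).2 i) / 2

theorem inner_sumField (x : M) (i : Fin 3) (v : TangentSpace IM x) :
    metric.inner x (sumField x i) v = 4 / 3 * sumCoord v i := by
  simp [metric_inner, sumField, ip_apply, sumCoord]
  ring

theorem inner_diffField (x : M) (i : Fin 3) (v : TangentSpace IM x) :
    metric.inner x (diffField x i) v = 4 * diffCoord v i := by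
  simp [metric_inner, diffField, ip_apply, diffCoord]
  ring

theorem sum_sumField_diffField (x : M) (v : TangentSpace IM x) :
    v = ∑ i, (sumCoord v i • sumField x i + diffCoord v i • diffField x i) := by
  apply injective_coframe x
  simp only [map_sum, map_add, map_smul, sumField, diffField, coframe_frame, sumCoord, diffCoord]
  ext i <;> fin_cases i <;> simp [Fin.sum_univ_three] <;> ring

/-- Indices in `Fin 3` are cyclic, so the pairs `(i + 1, i + 2)` run through an oriented basis of
`Λ²ℝ³ ≅ ℝ³`; with the nine mixed products this gives fifteen terms. -/
theorem alternating_expansion {A W : Type*} [AddCommGroup A] [Module ℝ A] [AddCommGroup W]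
    [Module ℝ W] (B : A →ₗ[ℝ] A →ₗ[ℝ] W) (h0 : ∀ v, B v v = 0)
    (hB : ∀ v w, B v w = -B w v) (p q : Fin 3 → A)
    (a b c d : Fin 3 → ℝ) :
    B (∑ i, (a i • p i + b i • q i)) (∑ i, (c i • p i + d i • q i)) =
      ∑ i, ((a (i + 1) * c (i + 2) - a (i + 2) * c (i + 1)) • B (p (i + 1)) (p (i + 2)) +
        (b (i + 1) * d (i + 2) - b (i + 2) * d (i + 1)) • B (q (i + 1)) (q (i + 2)) +
        ∑ j, (a i * d j - b j * c i) • B (p i) (q j)) := by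
  simp only [Fin.sum_univ_three, map_add, map_smul, LinearMap.add_apply, LinearMap.smul_apply, h0]
  simp only [show (0 : Fin 3) + 1 = 1 from rfl, show (0 : Fin 3) + 2 = 2 from rfl,
    show (1 : Fin 3) + 1 = 2 from rfl, show (1 : Fin 3) + 2 = 0 from rfl,
    show (2 : Fin 3) + 1 = 0 from rfl, show (2 : Fin 3) + 2 = 1 from rfl]
  rw [hB (p 1) (p 0), hB (p 0) (p 2), hB (p 2) (p 1),
    hB (q 1) (q 0), hB (q 0) (q 2), hB (q 2) (q 1),
    hB (q 0) (p 0), hB (q 0) (p 1), hB (q 0) (p 2),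
    hB (q 1) (p 0), hB (q 1) (p 1), hB (q 1) (p 2),
    hB (q 2) (p 0), hB (q 2) (p 1), hB (q 2) (p 2)]
  module

theorem wedge_expansion {x : M} (p q : Fin 3 → TangentSpace IM x) (a b c d : Fin 3 → ℝ) :
    wedge (∑ i, (a i • p i + b i • q i)) (∑ i, (c i • p i + d i • q i)) =
      ∑ i, ((a (i + 1) * c (i + 2) - a (i + 2) * c (i + 1)) • wedge (p (i + 1)) (p (i + 2)) +
        (b (i + 1) * d (i + 2) - b (i + 2) * d (i + 1)) • wedge (q (i + 1)) (q (i + 2)) +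
        ∑ j, (a i * d j - b j * c i) • wedge (p i) (q j)) :=
  alternating_expansion (LinearMap.mk₂ ℝ wedge wedge_add_left wedge_smul_left wedge_add_right
    wedge_smul_right) wedge_self wedge_swap p q a b c d

/-- The decomposition of an element of the second exterior power into eigenvectors. -/
theorem eigen_identity {W : Type*} [AddCommGroup W] [Module ℝ W] (a b c d : Fin 3 → ℝ)
    (p q : Fin 3 → W) (r : Fin 3 → Fin 3 → W) :
    (∑ i, (1 / 2 * (a (i + 1) * c (i + 2) - a (i + 2) * c (i + 1)) +
        3 / 2 * (b (i + 1) * d (i + 2) - b (i + 2) * d (i + 1))) • (p i + (1 / 3 : ℝ) • q i)) +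
      (((∑ i, (1 / 2 * (a (i + 1) * c (i + 2) - a (i + 2) * c (i + 1)) -
        3 / 2 * (b (i + 1) * d (i + 2) - b (i + 2) * d (i + 1))) • (p i - (1 / 3 : ℝ) • q i)) +
      ((∑ i, (1 / 2 * (a (i + 1) * d (i + 2) - b (i + 2) * c (i + 1)) -
        1 / 2 * (a (i + 2) * d (i + 1) - b (i + 1) * c (i + 2))) •
          (r (i + 1) (i + 2) - r (i + 2) (i + 1))) +
      (1 / 3 * ∑ i, (a i * d i - b i * c i)) • (r 0 0 + r 1 1 + r 2 2))) +
      (((∑ i, (1 / 2 * (a (i + 1) * d (i + 2) - b (i + 2) * c (i + 1)) +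
        1 / 2 * (a (i + 2) * d (i + 1) - b (i + 1) * c (i + 2))) •
          (r (i + 1) (i + 2) + r (i + 2) (i + 1)))) +
      ((1 / 2 * (a 0 * d 0 - b 0 * c 0) - 1 / 2 * (a 1 * d 1 - b 1 * c 1)) • (r 0 0 - r 1 1) +
      (1 / 6 * (a 0 * d 0 - b 0 * c 0) + 1 / 6 * (a 1 * d 1 - b 1 * c 1) -
        1 / 3 * (a 2 * d 2 - b 2 * c 2)) • (r 0 0 + r 1 1 - (2 : ℝ) • r 2 2)))) =
    ∑ i, ((a (i + 1) * c (i + 2) - a (i + 2) * c (i + 1)) • p i +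
        (b (i + 1) * d (i + 2) - b (i + 2) * d (i + 1)) • q i +
        ∑ j, (a i * d j - b j * c i) • r i j) := by
  simp only [Fin.sum_univ_three, show (0 : Fin 3) + 1 = 1 from rfl,
    show (0 : Fin 3) + 2 = 2 from rfl, show (1 : Fin 3) + 1 = 2 from rfl,
    show (1 : Fin 3) + 2 = 0 from rfl, show (2 : Fin 3) + 1 = 0 from rfl,
    show (2 : Fin 3) + 2 = 1 from rfl]
  module

/-- The index set of an eigenbasis of the curvature operator. -/
abbrev EigenIndex : Type := Fin 3 ⊕ (Fin 3 ⊕ Fin 3 ⊕ Fin 1) ⊕ (Fin 3 ⊕ Fin 2)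

/-- The eigenvalues of the curvature operator. -/
def eigenval : EigenIndex → ℝ :=
  Sum.elim (fun _ ↦ 7 / 24) (Sum.elim (fun _ ↦ 1 / 12) (fun _ ↦ -1 / 24))

/-- An eigenbasis of the curvature operator. -/
def eigenBivector (x : M) : EigenIndex → Bivector IM x :=
  Sum.elim
    (fun i ↦ wedge (sumField x (i + 1)) (sumField x (i + 2)) +
      (1 / 3 : ℝ) • wedge (diffField x (i + 1)) (diffField x (i + 2)))
    (Sum.elim
      (Sum.elim
        (fun i ↦ wedge (sumField x (i + 1)) (sumField x (i + 2)) -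
          (1 / 3 : ℝ) • wedge (diffField x (i + 1)) (diffField x (i + 2)))
        (Sum.elim
          (fun i ↦ wedge (sumField x (i + 1)) (diffField x (i + 2)) -
            wedge (sumField x (i + 2)) (diffField x (i + 1)))
          (fun _ ↦ wedge (sumField x 0) (diffField x 0) + wedge (sumField x 1) (diffField x 1) +
            wedge (sumField x 2) (diffField x 2))))
      (Sum.elim
        (fun i ↦ wedge (sumField x (i + 1)) (diffField x (i + 2)) +
          wedge (sumField x (i + 2)) (diffField x (i + 1)))
        ![wedge (sumField x 0) (diffField x 0) - wedge (sumField x 1) (diffField x 1),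
          wedge (sumField x 0) (diffField x 0) + wedge (sumField x 1) (diffField x 1) -
            (2 : ℝ) • wedge (sumField x 2) (diffField x 2)]))

/-- The squared norms of the eigenbasis of the curvature operator. -/
def eigenNormSq : EigenIndex → ℝ :=
  -- The sum and difference fields have squared lengths `4/3` and `4`, so their wedges have `32/9`
  -- (sum-sum), `32` (difference-difference) and `32/3` (mixed). The factor `1/3` in the
  -- eigenvectors equalizes the first two.
  Sum.elim (fun _ ↦ 64 / 9) (Sum.elim
    (Sum.elim (fun _ ↦ 64 / 9) (Sum.elim (fun _ ↦ 64 / 3) (fun _ ↦ 32)))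
    (Sum.elim (fun _ ↦ 64 / 3) ![64 / 3, 64]))

/-- The dual basis of the eigenbasis of the curvature operator. -/
def eigenDual (x : M) (k : EigenIndex) : Module.Dual ℝ (Bivector IM x) :=
  (eigenNormSq k)⁻¹ • bivectorInner metric x (eigenBivector x k)

theorem eigenDual_wedge (x : M) (k : EigenIndex) (X Y : TangentSpace IM x) :
    eigenDual x k (wedge X Y) =
      Sum.elim
        (fun i ↦ 1 / 2 * (sumCoord X (i + 1) * sumCoord Y (i + 2) -
            sumCoord X (i + 2) * sumCoord Y (i + 1)) +
          3 / 2 * (diffCoord X (i + 1) * diffCoord Y (i + 2) -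
            diffCoord X (i + 2) * diffCoord Y (i + 1)))
        (Sum.elim
          (Sum.elim
            (fun i ↦ 1 / 2 * (sumCoord X (i + 1) * sumCoord Y (i + 2) -
                sumCoord X (i + 2) * sumCoord Y (i + 1)) -
              3 / 2 * (diffCoord X (i + 1) * diffCoord Y (i + 2) -
                diffCoord X (i + 2) * diffCoord Y (i + 1)))
            (Sum.elim
              (fun i ↦ 1 / 2 * (sumCoord X (i + 1) * diffCoord Y (i + 2) -
                  diffCoord X (i + 2) * sumCoord Y (i + 1)) -
                1 / 2 * (sumCoord X (i + 2) * diffCoord Y (i + 1) -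
                  diffCoord X (i + 1) * sumCoord Y (i + 2)))
              (fun _ ↦ 1 / 3 * ∑ i, (sumCoord X i * diffCoord Y i - diffCoord X i * sumCoord Y i))))
          (Sum.elim
            (fun i ↦ 1 / 2 * (sumCoord X (i + 1) * diffCoord Y (i + 2) -
                diffCoord X (i + 2) * sumCoord Y (i + 1)) +
              1 / 2 * (sumCoord X (i + 2) * diffCoord Y (i + 1) -
                diffCoord X (i + 1) * sumCoord Y (i + 2)))
            ![1 / 2 * (sumCoord X 0 * diffCoord Y 0 - diffCoord X 0 * sumCoord Y 0) -
                1 / 2 * (sumCoord X 1 * diffCoord Y 1 - diffCoord X 1 * sumCoord Y 1),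
              1 / 6 * (sumCoord X 0 * diffCoord Y 0 - diffCoord X 0 * sumCoord Y 0) +
                1 / 6 * (sumCoord X 1 * diffCoord Y 1 - diffCoord X 1 * sumCoord Y 1) -
                1 / 3 * (sumCoord X 2 * diffCoord Y 2 - diffCoord X 2 * sumCoord Y 2)])) k := by
  rcases k with i | (i | i | i) | (i | i)
  on_goal 6 => fin_cases i
  all_goals
    simp [eigenDual, eigenNormSq, eigenBivector, bivectorInner_wedge, inner_sumField,
      inner_diffField, Fin.sum_univ_three]
    ring

/-- By linearity it is enough to treat a wedge; expanding both vectors in the sum and difference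
fields turns the claim into `eigen_identity`. -/
theorem eigen_decomposition (x : M) (u : Bivector IM x) :
    ∑ k, eigenDual x k u • eigenBivector x k = u := by
  have h : (∑ k, (eigenDual x k).smulRight (eigenBivector x k)) = LinearMap.id := by
    refine bivector_induction fun X Y ↦ ?_
    have e : wedge X Y = wedge _ _ :=
      congrArg₂ wedge (sum_sumField_diffField x X) (sum_sumField_diffField x Y)
    rw [wedge_expansion] at e
    rw [LinearMap.sum_apply]
    simp only [LinearMap.smulRight_apply, eigenDual_wedge]
    refine Eq.trans ?_ e.symm
    refine Eq.trans ?_ (eigen_identity (W := Bivector IM x) (sumCoord X) (diffCoord X) (sumCoord Y)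
      (diffCoord Y) (fun i ↦ wedge (sumField x (i + 1)) (sumField x (i + 2)))
      (fun i ↦ wedge (diffField x (i + 1)) (diffField x (i + 2)))
      (fun i j ↦ wedge (sumField x i) (diffField x j)))
    simp only [Fintype.sum_sum_type, Fin.sum_univ_one, Fin.sum_univ_two, Sum.elim_inl, Sum.elim_inr,
      eigenBivector, Matrix.cons_val_zero, Matrix.cons_val_one]
  have := congrArg (fun f ↦ f u) h
  simpa using this

/-- The curvature operator of the standard homogeneous metric. -/
def curvatureOperator (x : M) : Module.End ℝ (Bivector IM x) :=
  ∑ k, (eigenval k • eigenDual x k).smulRight (eigenBivector x k)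

theorem eigenNormSq_pos (k : EigenIndex) : 0 < eigenNormSq k := by
  rcases k with i | (i | i | i) | (i | i)
  on_goal 6 => fin_cases i
  all_goals simp [eigenNormSq]

theorem bivectorInner_curvatureOperator (x : M) (u v : Bivector IM x) :
    bivectorInner metric x (curvatureOperator x u) v =
      ∑ k, eigenval k * eigenNormSq k * eigenDual x k u * eigenDual x k v := by
  simp only [curvatureOperator, LinearMap.sum_apply, map_sum, LinearMap.smulRight_apply,
    LinearMap.smul_apply, map_smul, smul_eq_mul]
  refine Finset.sum_congr rfl fun k _ ↦ ?_
  have h := (eigenNormSq_pos k).ne'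
  simp only [eigenDual, LinearMap.smul_apply, smul_eq_mul]
  field_simp

theorem curvature4_eq (x : M) (X Y Z W : TangentSpace IM x) :
    curvature4 metric curvatureTensor x X Y Z W =
      ip (curv (coframe x X) (coframe x Y) (coframe x W)) (coframe x Z) := by
  rw [curvature4, metric_inner, coframe_curvatureTensor]

/-- The operator is defined by its spectral sum, so its quadratic form is a weighted sum of products
of dual coordinates. Matching it with the curvature is a polynomial identity in the frame
coefficients of the four vectors. -/
theorem isCurvatureOperatorAt_curvatureOperator (x : M) :
    IsCurvatureOperatorAt metric curvatureTensor x (curvatureOperator x) := by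
  intro X Y Z W
  rw [bivectorInner_curvatureOperator, curvature4_eq]
  simp only [eigenDual_wedge, Fintype.sum_sum_type, Fin.sum_univ_three, Fin.sum_univ_two,
    Fin.sum_univ_one, Sum.elim_inl, Sum.elim_inr, eigenval, eigenNormSq, Matrix.cons_val_zero,
    Matrix.cons_val_one, show (0 : Fin 3) + 1 = 1 from rfl, show (0 : Fin 3) + 2 = 2 from rfl,
    show (1 : Fin 3) + 1 = 2 from rfl, show (1 : Fin 3) + 2 = 0 from rfl,
    show (2 : Fin 3) + 1 = 0 from rfl, show (2 : Fin 3) + 2 = 1 from rfl, sumCoord, diffCoord]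
  generalize coframe x X = a
  generalize coframe x Y = b
  generalize coframe x Z = c
  generalize coframe x W = d
  obtain ⟨a, a'⟩ := a
  obtain ⟨b, b'⟩ := b
  obtain ⟨c, c'⟩ := c
  obtain ⟨d, d'⟩ := d
  simp [curv_apply, lc_apply, br_apply, cross_apply, ip_apply, dotProduct, Fin.sum_univ_three]
  ring

theorem card_eigenIndex (x : M) :
    Fintype.card EigenIndex = Module.finrank ℝ (Bivector IM x) := by
  have h : Module.finrank ℝ (TangentSpace IM x) = 6 := by
    rw [(coframeEquiv x).finrank_eq]; simp
  rw [exteriorPower.finrank_eq, h]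
  decide

/-- A basis of eigenvectors of the curvature operator. -/
def eigenBasis (x : M) : Module.Basis EigenIndex ℝ (Bivector IM x) :=
  basisOfDecomposition (eigen_decomposition x) (card_eigenIndex x)

theorem curvatureOperator_eigenBasis (x : M) (k : EigenIndex) :
    curvatureOperator x (eigenBasis x k) = eigenval k • eigenBasis x k := by
  have hb : eigenBasis x k = eigenBivector x k := by simp [eigenBasis, basisOfDecomposition]
  rw [hb, ← sum_smul_of_decomposition (eigen_decomposition x) (card_eigenIndex x) eigenval k]
  simp [curvatureOperator]

theorem hasEigenvalue_curvatureOperator (x : M) :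
    {μ : ℝ | (curvatureOperator x).HasEigenvalue μ} = {7 / 24, 1 / 12, -1 / 24} := by
  ext μ
  rw [Set.mem_ofPred_eq, hasEigenvalue_iff_of_basis _ (curvatureOperator_eigenBasis x)]
  simp [eigenval, eq_comm]

theorem finrank_eigenspace_curvatureOperator (x : M) (μ : ℝ) :
    Module.finrank ℝ ((curvatureOperator x).eigenspace μ) =
      (if 7 / 24 = μ then 3 else 0) + ((if 1 / 12 = μ then 7 else 0) +
        if -1 / 24 = μ then 5 else 0) := by
  rw [finrank_eigenspace_of_basis _ (curvatureOperator_eigenBasis x), Finset.card_filter]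
  simp only [Fintype.sum_sum_type, eigenval, Sum.elim_inl, Sum.elim_inr]
  by_cases h₁ : 7 / 24 = μ <;> by_cases h₂ : 1 / 12 = μ <;> by_cases h₃ : -1 / 24 = μ <;>
    simp only [h₁, h₂, h₃, if_true, if_false, Finset.sum_const] <;> rfl

end NearlyKahlerS3S3

end
theorem mainTheorem8 :
    ∃ g : NearlyKahlerS3S3.SmoothMetric NearlyKahlerS3S3.IM NearlyKahlerS3S3.M,
      NearlyKahlerS3S3.IsStandardMetric g ∧
      (∀ g', NearlyKahlerS3S3.IsStandardMetric g' → g' = g) ∧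
      ∃ (cov : NearlyKahlerS3S3.Connection NearlyKahlerS3S3.IM NearlyKahlerS3S3.M)
        (R : NearlyKahlerS3S3.CurvatureTensor NearlyKahlerS3S3.IM NearlyKahlerS3S3.M),
        NearlyKahlerS3S3.IsLeviCivita g cov ∧
        NearlyKahlerS3S3.IsCurvatureTensor cov R ∧
        NearlyKahlerS3S3.IsStrictNearlyKahler g cov ∧
        NearlyKahlerS3S3.IsEinstein g R (5 / 12) ∧
        ¬ NearlyKahlerS3S3.IsSymmetricSpace g ∧
        ∀ x : NearlyKahlerS3S3.M,
          ∃ Rop : Module.End ℝ (NearlyKahlerS3S3.Bivector NearlyKahlerS3S3.IM x),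
            NearlyKahlerS3S3.IsCurvatureOperatorAt g R x Rop ∧
            {μ : ℝ | Rop.HasEigenvalue μ} = {7 / 24, 1 / 12, -1 / 24} ∧
            Module.finrank ℝ (Rop.eigenspace (7 / 24)) = 3 ∧
            Module.finrank ℝ (Rop.eigenspace (1 / 12)) = 7 ∧
            Module.finrank ℝ (Rop.eigenspace (-1 / 24)) = 5 ∧
            ∃ μmax : ℝ, IsGreatest {μ : ℝ | Rop.HasEigenvalue μ} μmax ∧ μmax < 5 / 12 := by
  open NearlyKahlerS3S3 in
  refine ⟨metric, isStandardMetric_metric, fun g hg ↦ hg.eq_metric, connection, curvatureTensor,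
    isLeviCivita_connection, isCurvatureTensor_curvatureTensor, isStrictNearlyKahler_metric,
    isEinstein_metric, not_isSymmetricSpace_metric, fun x ↦ ⟨curvatureOperator x,
    isCurvatureOperatorAt_curvatureOperator x, hasEigenvalue_curvatureOperator x, ?_, ?_, ?_,
    7 / 24, ?_, by norm_num⟩⟩
  · rw [NearlyKahlerS3S3.finrank_eigenspace_curvatureOperator]; norm_num
  · rw [NearlyKahlerS3S3.finrank_eigenspace_curvatureOperator]; norm_num
  · rw [NearlyKahlerS3S3.finrank_eigenspace_curvatureOperator]; norm_num
  -- The greatest eigenvalue is `7/24`, below `5/12 = 10/24`.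
  · rw [NearlyKahlerS3S3.hasEigenvalue_curvatureOperator]
    refine ⟨Or.inl rfl, ?_⟩
    rintro μ (rfl | rfl | rfl) <;> norm_num
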